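/- Let $(A,\mathfrak m)$ be a one-dimensional (noetherian) Cohen–Macaulay local ring with infinite residue field, and let $\lambda$ denote length of $A$-modules. Let $b=\lambda(\mathfrak m/\mathfrak m^2)$ be its embedding dimension and $e$ its multiplicity, i.e. the integer with $\sum_{i=0}^n\lambda(\mathfrak m^i/\mathfrak m^{i+1})=e(n+1)-\rho$ for some integer $\rho$ and all large $n$. Let $r$ be its reduction number, i.e. the least $n$ with $\mathfrak m^{n+1}=x\mathfrak m^n$ for a minimal reduction $xA$ of $\mathfrak m$ (it does not depend on the minimal reduction). Assume that $A$ has almost minimal multiplicity, i.e. $e=b+1$, and that $r\ge 3$. Let $xA$ be any minimal reduction of $\mathfrak m$. Define the following invariants. * The Apery invariants with respect to $x$: $\gamma_i=\lambda\big((\mathfrak m^i+xA)/(\mathfrak m^{i+1}+xA)\big)$ for $1\le i\le r$. * The invariants of the tangent cone with respect to $x$: let $G(\mathfrak m)=\bigoplus_{n\ge0}\mathfrak m^n/\mathfrak m^{n+1}$, regarded as a graded module over $F(x)=\bigoplus_{n\ge0}x^nA/x^n\mathfrak m$, and let $x^*\in F(x)$ be the class of $x$ in degree one. The numbers $\alpha_i,\alpha_{i,j}\ge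 0$ are those in a decomposition into graded $F(x)$-modules $$G(\mathfrak m)\cong\bigoplus_{i=0}^{r}F(x)(-i)^{\alpha_i}\ \oplus\ \bigoplus_{i=1}^{r-1}\bigoplus_{j=1}^{r-i}\Big(\frac{F(x)}{(x^*)^jF(x)}(-i)\Big)^{\alpha_{i,j}} .$$ * The micro-invariants: let $A'$ be the first neighborhood ring of $A$, i.e. the subring of the total ring of fractions of $A$ consisting of all $c/a$ with $c\in\mathfrak m^s$ and $a\in\mathfrak m^s$ superficial of degree $s$ (that is, $\mathfrak m^{n+s}=a\,\mathfrak m^n$ for all large $n$), for some $s\ge0$. For $1\le i\le r$, $$\beta_i=\lambda\Big(\frac{A+\mathfrak m^{i-1}A'}{A+\mathfrak m^{i}A'}\Big)-\lambda\Big(\frac{A+\mathfrak m^{i}A'}{A+\mathfrak m^{i+1}A'}\Big).$$ Then: 1. $(\gamma_1,\gamma_2,\gamma_3,\dots,\gamma_r)=(e-2,1,0,\dots,0)$. 2. A decomposition of $G(\mathfrak m)$ as above exists, and in every such decomposition $\alpha_r=\alpha_{r-1}=1$. 3. The two lengths in the definition of $\beta_r$ are finite, and $\beta_r=0$. -/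

import Mathlib

open IsLocalRing Polynomial
open scoped DirectSum nonZeroDivisors

noncomputable section

namespace TangentConeInvariants

theorem reesAlgebra_mono {A : Type*} [CommRing A] {I J : Ideal A} (h : I ≤ J) : reesAlgebra I ≤ reesAlgebra J :=
  fun _ hf i => Ideal.pow_right_mono h i (hf i)

variable (A : Type*) [CommRing A] [IsLocalRing A]

/-- A local ring is Cohen–Macaulay if its maximal ideal contains a regular sequence whose length is
the Krull dimension of the ring. -/
def IsCohenMacaulay : Prop :=
  ∃ rs : List A, (∀ a ∈ rs, a ∈ maximalIdeal A) ∧ RingTheory.Sequence.IsRegular A rs ∧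
    (rs.length : WithBot ℕ∞) = ringKrullDim A

variable {A}

/-- The length `λ(M / (M ∩ N))` over `A`; it is `λ(M / N)` when `N ≤ M`. -/
def relLength {P : Type*} [AddCommGroup P] [Module A P] (M N : Submodule A P) : ℕ∞ :=
  Module.length A (M ⧸ N.submoduleOf M)

/-- `J` is a reduction of `I`. -/
def IsReduction (J I : Ideal A) : Prop :=
  J ≤ I ∧ ∃ n : ℕ, J * I ^ n = I ^ (n + 1)

/-- `xA` is a minimal reduction of the maximal ideal: it is a reduction, and no reduction of the
maximal ideal is strictly smaller. -/
def GeneratesMinimalReduction (x : A) : Prop :=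
  Minimal (fun J : Ideal A => IsReduction J (maximalIdeal A)) (Ideal.span {x})

variable (A)

/-- The reduction number of `A`: the least `n` with `𝔪 ^ (n + 1) = x 𝔪 ^ n` for a minimal
reduction `xA` of `𝔪`. (In a one-dimensional Cohen–Macaulay local ring with infinite residue
field the minimal reductions of `𝔪` are principal and all of them give the same least `n`.) -/
def reductionNumber : ℕ :=
  sInf {n : ℕ | ∃ x : A, GeneratesMinimalReduction x ∧
    maximalIdeal A ^ (n + 1) = Ideal.span {x} * maximalIdeal A ^ n}

/-- The Hilbert function `H(n) = λ(𝔪 ^ n / 𝔪 ^ (n + 1))`; these lengths are finite when `A` is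
noetherian. -/
def hilbertFunction (n : ℕ) : ℕ :=
  (relLength (maximalIdeal A ^ n) (maximalIdeal A ^ (n + 1))).toNat

/-- The embedding dimension `b = λ(𝔪 / 𝔪 ^ 2)`. -/
def embeddingDimension : ℕ := hilbertFunction A 1

/-- The multiplicity of a one-dimensional local ring: the integer `e` such that
`∑_{i ≤ n} H(i) = e (n + 1) - ρ` for some integer `ρ` and all large `n`. -/
def ringMultiplicity : ℕ :=
  sInf {e : ℕ | ∃ ρ : ℤ, ∀ᶠ n : ℕ in Filter.atTop,
    ((∑ i ∈ Finset.range (n + 1), hilbertFunction A i : ℕ) : ℤ) = e * (n + 1) - ρ}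

/-- `A` has almost minimal multiplicity: `e = b + 1`. -/
def HasAlmostMinimalMultiplicity : Prop :=
  ringMultiplicity A = embeddingDimension A + 1

variable {A}

/-! Apery invariants -/

/-- The Apery invariant `γ_i = λ((𝔪 ^ i + xA) / (𝔪 ^ (i + 1) + xA))` with respect to `x`. -/
def aperyInvariant (x : A) (i : ℕ) : ℕ∞ :=
  relLength (maximalIdeal A ^ i ⊔ Ideal.span {x}) (maximalIdeal A ^ (i + 1) ⊔ Ideal.span {x})

/-! Micro-invariants -/

/-- `a` is a superficial element of degree `s`. -/
def IsSuperficial (s : ℕ) (a : A) : Prop :=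
  a ∈ maximalIdeal A ^ s ∧
    ∀ᶠ n : ℕ in Filter.atTop, maximalIdeal A ^ (n + s) = Ideal.span {a} * maximalIdeal A ^ n

theorem IsSuperficial.mul {s t : ℕ} {a c : A} (ha : IsSuperficial s a) (hc : IsSuperficial t c) :
    IsSuperficial (s + t) (a * c) := by
  refine ⟨by rw [pow_add]; exact Ideal.mul_mem_mul ha.1 hc.1, ?_⟩
  have h := (Filter.tendsto_add_atTop_nat t).eventually ha.2
  filter_upwards [h, hc.2] with n h1 h2
  rw [show n + (s + t) = n + t + s by ring, h1, h2, ← mul_assoc,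
    Ideal.span_singleton_mul_span_singleton]

variable (A)

/-- The first neighborhood ring `A'`: the subring of the total ring of fractions of `A` formed by
the fractions `b / a` with `b ∈ 𝔪 ^ s` and `a` a (regular) superficial element of degree `s`. -/
def firstNeighborhoodRing : Subalgebra A (FractionRing A) where
  carrier := {z | ∃ (s : ℕ) (a : A⁰) (b : A), IsSuperficial s (a : A) ∧
    b ∈ maximalIdeal A ^ s ∧ z = IsLocalization.mk' (FractionRing A) b a}
  mul_mem' := by
    rintro _ _ ⟨s, a, b, ha, hb, rfl⟩ ⟨t, c, d, hc, hd, rfl⟩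
    refine ⟨s + t, a * c, b * d, ha.mul hc, ?_, (IsLocalization.mk'_mul _ _ _ _ _).symm⟩
    rw [pow_add]; exact Ideal.mul_mem_mul hb hd
  add_mem' := by
    rintro _ _ ⟨s, a, b, ha, hb, rfl⟩ ⟨t, c, d, hc, hd, rfl⟩
    refine ⟨s + t, a * c, b * c + d * a, ha.mul hc, ?_, (IsLocalization.mk'_add _ _ _ _).symm⟩
    refine Ideal.add_mem _ ?_ ?_
    · rw [pow_add]; exact Ideal.mul_mem_mul hb hc.1
    · rw [add_comm, pow_add]; exact Ideal.mul_mem_mul hd ha.1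
  algebraMap_mem' b := ⟨0, 1, b, ⟨by simp, by simp⟩, by simp, (IsLocalization.mk'_one _ b).symm⟩

/-- The `A`-submodule `A + 𝔪 ^ i A'` of the total ring of fractions of `A`. -/
def neighborhoodFiltration (i : ℕ) : Submodule A (FractionRing A) :=
  1 ⊔ maximalIdeal A ^ i • Subalgebra.toSubmodule (firstNeighborhoodRing A)

/-- The length `λ((A + 𝔪 ^ i A') / (A + 𝔪 ^ (i + 1) A'))`. -/
def microLength (i : ℕ) : ℕ∞ :=
  relLength (neighborhoodFiltration A i) (neighborhoodFiltration A (i + 1))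

/-- The micro-invariants: `β_0 = 1` and, for `i ≥ 1`, `β_i` is
`λ((A + 𝔪 ^ (i - 1) A') / (A + 𝔪 ^ i A')) - λ((A + 𝔪 ^ i A') / (A + 𝔪 ^ (i + 1) A'))`. -/
def microInvariant : ℕ → ℤ
  | 0 => 1
  | i + 1 => ((microLength A i).toNat : ℤ) - ((microLength A (i + 1)).toNat : ℤ)

variable {A}

/-! Invariants of the tangent cone -/

/-- The graded ring `⨁ₙ I ^ n / 𝔪 I ^ n`, as the quotient of the Rees algebra `⨁ₙ I ^ n tⁿ` by the
ideal generated by `𝔪`. -/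
def FiberCone (I : Ideal A) : Type _ :=
  reesAlgebra I ⧸ (maximalIdeal A).map (algebraMap A (reesAlgebra I))

instance (I : Ideal A) : CommRing (FiberCone I) :=
  inferInstanceAs (CommRing (reesAlgebra I ⧸ (maximalIdeal A).map (algebraMap A (reesAlgebra I))))

/-- The quotient homomorphism from the Rees algebra. -/
def FiberCone.mk (I : Ideal A) : reesAlgebra I →+* FiberCone I :=
  Ideal.Quotient.mk ((maximalIdeal A).map (algebraMap A (reesAlgebra I)))

/-- The class in degree `n` of an element of `I ^ n`. -/
def FiberCone.of (I : Ideal A) (n : ℕ) (a : A) (ha : a ∈ I ^ n) : FiberCone I :=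
  FiberCone.mk I ⟨monomial n a, reesAlgebra.monomial_mem.2 ha⟩

/-- The homogeneous elements of degree `n` (zero included): the component `I ^ n / 𝔪 I ^ n`. -/
def FiberCone.component (I : Ideal A) (n : ℕ) : Set (FiberCone I) :=
  {z | ∃ (a : A) (ha : a ∈ I ^ n), z = FiberCone.of I n a ha}

/-- The graded ring homomorphism `⨁ₙ I ^ n / 𝔪 I ^ n → ⨁ₙ J ^ n / 𝔪 J ^ n` induced by an inclusion
`I ≤ J`. -/
def FiberCone.map {I J : Ideal A} (h : I ≤ J) : FiberCone I →+* FiberCone J :=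
  Ideal.quotientMap _ (Subalgebra.inclusion (reesAlgebra_mono h)).toRingHom <| by
    rw [Ideal.map_le_iff_le_comap]
    intro a ha
    exact Ideal.mem_map_of_mem (algebraMap A (reesAlgebra J)) ha

variable (A) in
/-- The tangent cone `G(𝔪) = ⨁ₙ 𝔪 ^ n / 𝔪 ^ (n + 1)`. -/
abbrev TangentCone : Type _ := FiberCone (maximalIdeal A)

/-- The ring `F(x) = ⨁ₙ xⁿA / xⁿ𝔪`. -/
abbrev NoetherNormalization (x : A) : Type _ := FiberCone (Ideal.span {x})

/-- The element `x^*` of `F(x)`: the class of `x` in degree one. -/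
def initialForm (x : A) : NoetherNormalization x :=
  FiberCone.of (Ideal.span {x}) 1 x (by simp)

/-- The cyclic module `F(x) / (x^*)^j F(x)`. -/
abbrev TruncatedNormalization (x : A) (j : ℕ) : Type _ :=
  NoetherNormalization x ⧸ Ideal.span {initialForm x ^ j}

/-- Indices of the free summands: `α i` summands for each `0 ≤ i ≤ r`. -/
abbrev FreeIndex (r : ℕ) (α : ℕ → ℕ) : Type := Σ i : Fin (r + 1), Fin (α i)

/-- Indices of the torsion summands: `τ i j` summands for `1 ≤ i ≤ r - 1` and `1 ≤ j ≤ r - i`. -/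
abbrev TorsionIndex (r : ℕ) (τ : ℕ → ℕ → ℕ) : Type :=
  Σ p : {p : ℕ × ℕ // 1 ≤ p.1 ∧ 1 ≤ p.2 ∧ p.1 + p.2 ≤ r}, Fin (τ p.1.1 p.1.2)

/-- The numbers `α i` and `τ i j` are the invariants of the tangent cone with respect to `x`: there
is an isomorphism of graded `F(x)`-modules
`G(𝔪) ≅ ⨁_{0 ≤ i ≤ r} F(x)(-i) ^ (α i) ⊕
  ⨁_{1 ≤ i ≤ r - 1} ⨁_{1 ≤ j ≤ r - i} (F(x) / (x^*)^j F(x))(-i) ^ (τ i j)`.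
The module structure of `G(𝔪)` comes from the homomorphism `F(x) → G(𝔪)`, and an element of degree
`d` in `F(x)` has degree `d + i` in the shifted module `F(x)(-i)`. -/
def AreTangentConeInvariants (x : A) (hx : Ideal.span {x} ≤ maximalIdeal A) (r : ℕ)
    (α : ℕ → ℕ) (τ : ℕ → ℕ → ℕ) : Prop :=
  ∃ φ : ((⨁ _ : FreeIndex r α, NoetherNormalization x) ×
      (⨁ t : TorsionIndex r τ, TruncatedNormalization x t.1.1.2)) ≃+ TangentCone A,
    (∀ (f : NoetherNormalization x) v, φ (f • v) = FiberCone.map hx f * φ v) ∧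
    (∀ (t : FreeIndex r α) (d : ℕ), ∀ f ∈ FiberCone.component (Ideal.span {x}) d,
      φ (DirectSum.of (fun _ : FreeIndex r α => NoetherNormalization x) t f, 0) ∈
        FiberCone.component (maximalIdeal A) (d + t.1)) ∧
    (∀ (t : TorsionIndex r τ) (d : ℕ), ∀ f ∈ FiberCone.component (Ideal.span {x}) d,
      φ (0, DirectSum.of (fun t : TorsionIndex r τ => TruncatedNormalization x t.1.1.2) t
          (Ideal.Quotient.mk _ f)) ∈
        FiberCone.component (maximalIdeal A) (d + t.1.1.1))

end TangentConeInvariants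

end

/-! A generator `x` of a minimal reduction is regular, because a power of 𝔪 lies in xA and 𝔪
contains a regular element. Computing λ(A/x𝔪ⁿ) in two ways gives H(n) + λ(𝔪ⁿ⁺¹/x𝔪ⁿ) = λ(A/xA), and
the right side is e because the second term vanishes for large n. So 𝔪ⁿ⁺¹ = x𝔪ⁿ exactly when H(n) =
e, a condition free of `x`: all minimal reductions give the same r.

At n = 1 the equality e = b + 1 says that 𝔪²/x𝔪 has length one. Hence 𝔪² = x𝔪 + (yz) with 𝔪yz ⊆ x𝔪,
and inductively 𝔪ⁿ⁺¹ = x𝔪ⁿ + (yⁿz) with 𝔪yⁿz ⊆ x𝔪ⁿ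
(`HasAlmostMinimalMultiplicity.exists_generator`). Everything else rests on this.

Apery invariants: 𝔪³ ⊆ xA while yz ∉ xA, so γ₂ = 1, the later ones vanish, and γ₁ is what remains of
e = λ(A/xA).

Micro-invariants: since 𝔪ʳ ⊆ xA and 𝔪ⁿ⁺¹ = x𝔪ⁿ for n ≥ r, already 𝔪ʳ⁻¹A' ⊆ A, so both lengths in βᵣ
are zero.

Tangent cone: a decomposition comes from structure theory for graded modules over a ring spanned by
the powers of one element (`exists_graded_decomposition`). In any decomposition, the number of
generators of degree N is the dimension of G_N/x*G_{N-1} (see `existsUnique_generator`), which is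
one for 2 ≤ N ≤ r. In degree r no torsion summand is allowed; in degree r - 1 it would be killed by
x*, which is injective there. So the single generator in each of these degrees is free. -/

namespace TangentConeInvariants

/-! ### Relative lengths, covering relations and Nakayama. -/

section Length

variable {A : Type*} [CommRing A] {P : Type*} [AddCommGroup P] [Module A P]

theorem relLength_eq_zero {M N : Submodule A P} (h : M ≤ N) : relLength M N = 0 := by
  have : Subsingleton (M ⧸ N.submoduleOf M) := by
    rw [Submodule.Quotient.subsingleton_iff, Submodule.submoduleOf_eq_top]
    exact h
  exact Module.length_eq_zero

theorem relLength_add_length {M N : Submodule A P} (h : N ≤ M) :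
    relLength M N + Module.length A (P ⧸ M) = Module.length A (P ⧸ N) := by
  symm
  change _ = Module.length A (M ⧸ N.comap M.subtype) + _
  refine Module.length_eq_add_of_exact (Submodule.mapQ (N.comap M.subtype) N M.subtype le_rfl)
    (Submodule.factor h) ?_ (Submodule.factor_surjective h) ?_
  · rw [← LinearMap.ker_eq_bot, Submodule.ker_mapQ]
    exact Submodule.mkQ_map_self _
  · rw [LinearMap.exact_iff, Submodule.range_mapQ, Submodule.range_subtype, Submodule.factor,
      Submodule.ker_mapQ, Submodule.comap_id]

theorem relLength_eq_one_iff {M N : Submodule A P} (h : N ≤ M) :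
    relLength M N = 1 ↔ N ⋖ M := by
  rw [covBy_iff_quot_is_simple h]
  exact Module.length_eq_one_iff

/-- Length is additive on 0 → A/I → A/xI → A/xA → 0, whose first map is multiplication by `x`; it is
injective because `x` is regular. -/
theorem length_quotient_span_singleton_mul {x : A} (hx : x ∈ A⁰) (I : Ideal A) :
    Module.length A (A ⧸ Ideal.span {x} * I) =
      Module.length A (A ⧸ I) + Module.length A (A ⧸ Ideal.span {x}) := by
  have hle : I ≤ Submodule.comap (LinearMap.mulLeft A x) (Ideal.span {x} * I) := fun y hy =>
    Ideal.mul_mem_mul (Ideal.mem_span_singleton_self x) hy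
  refine Module.length_eq_add_of_exact (Submodule.mapQ I (Ideal.span {x} * I) _ hle)
    (Submodule.factor Ideal.mul_le_left) ?_ (Submodule.factor_surjective _) ?_
  · rw [← LinearMap.ker_eq_bot, Submodule.ker_mapQ, eq_bot_iff, Submodule.map_le_iff_le_comap,
      show (⊥ : Submodule A _).comap I.mkQ = _ from I.ker_mkQ]
    intro y hy
    obtain ⟨z, hz, hzy⟩ := Ideal.mem_span_singleton_mul.1 hy
    have : x * z = x * y := hzy
    rwa [← (mul_cancel_left_mem_nonZeroDivisors hx).1 this]
  · rw [LinearMap.exact_iff, Submodule.range_mapQ, Submodule.factor, Submodule.ker_mapQ,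
      Submodule.comap_id]
    congr 1
    ext y
    simp [Ideal.mem_span_singleton', mul_comm]

variable [IsLocalRing A]

theorem covBy_sup_span_singleton {N : Submodule A P} {w : P}
    (hw : ∀ a ∈ maximalIdeal A, a • w ∈ N) (hwN : w ∉ N) : N ⋖ N ⊔ Submodule.span A {w} := by
  refine ⟨lt_of_le_not_ge le_sup_left fun h => hwN ?_, fun K hK hK' => hK'.not_ge ?_⟩
  · exact h (Submodule.mem_sup_right (Submodule.mem_span_singleton_self w))
  · obtain ⟨u, hu, huN⟩ := Set.exists_of_ssubset hK
    obtain ⟨n, hn, c, hc⟩ : ∃ n ∈ N, ∃ c : A, n + c • w = u := by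
      simpa [Submodule.mem_sup, Submodule.mem_span_singleton] using hK'.le hu
    have hc' : IsUnit c := by
      by_contra h
      exact huN (hc ▸ N.add_mem hn (hw c h))
    have hcw : c • w ∈ K := by
      rw [← eq_sub_iff_add_eq'] at hc
      exact hc ▸ K.sub_mem hu (hK.le hn)
    refine sup_le hK.le ((Submodule.span_singleton_le_iff_mem _ _).2 ?_)
    obtain ⟨c, rfl⟩ := hc'
    simpa [smul_smul] using K.smul_mem (↑c⁻¹ : A) hcw

/-- N + 𝔪M lies between N and M, so it is one of them; by Nakayama it cannot be M. -/
theorem smul_mem_of_covBy {M N : Submodule A P} (hM : M.FG) (h : N ⋖ M)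
    {a : A} (ha : a ∈ maximalIdeal A) {w : P} (hw : w ∈ M) : a • w ∈ N := by
  have h1 : N ⊔ maximalIdeal A • M ≤ M := sup_le h.le Submodule.smul_le_right
  rcases h.eq_or_eq le_sup_left h1 with h2 | h2
  · exact h2 ▸ Submodule.mem_sup_right (Submodule.smul_mem_smul ha hw)
  · exact absurd (Submodule.le_of_le_smul_of_le_jacobson_bot hM
      (maximalIdeal_le_jacobson _) h2.ge) h.lt.not_ge

theorem length_quotient_ne_top [IsNoetherianRing A] {I : Ideal A} {n : ℕ}
    (h : maximalIdeal A ^ n ≤ I) : Module.length A (A ⧸ I) ≠ ⊤ := by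
  by_cases hI : I = ⊤
  · have : Subsingleton (A ⧸ I) := by rwa [Submodule.Quotient.subsingleton_iff]
    rw [Module.length_eq_zero]; exact ENat.zero_ne_top
  have : Nontrivial (A ⧸ I) := Ideal.Quotient.nontrivial_iff.2 hI
  have : IsLocalRing (A ⧸ I) := .of_surjective' _ Ideal.Quotient.mk_surjective
  have : IsArtinianRing (A ⧸ I) := by
    rw [isArtinianRing_iff_isNilpotent_maximalIdeal]
    refine ⟨n, ?_⟩
    rw [← IsLocalRing.map_maximalIdeal_of_surjective (Ideal.Quotient.mk I)
      Ideal.Quotient.mk_surjective, ← Ideal.map_pow, Ideal.zero_eq_bot,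
      Ideal.map_eq_bot_iff_le_ker, Ideal.mk_ker]
    exact h
  rw [Module.length_eq_of_surjective (R := A ⧸ I) Ideal.Quotient.mk_surjective]
  exact Module.length_ne_top

end Length

/-! ### Hilbert function, multiplicity and reduction number. -/

section Reduction

theorem IsReduction.eventually_eq {A : Type*} [CommRing A] {J I : Ideal A} (h : IsReduction J I) :
    ∃ N, ∀ n, N ≤ n → I ^ (n + 1) = J * I ^ n := by
  obtain ⟨N, hN⟩ := h.2
  refine ⟨N, fun n hn => ?_⟩
  obtain ⟨k, rfl⟩ := Nat.exists_eq_add_of_le hn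
  rw [pow_add _ N, ← mul_assoc, hN, ← pow_add]
  congr 1; omega

variable {A : Type*} [CommRing A] [IsLocalRing A]

theorem IsCohenMacaulay.exists_mem_nonZeroDivisors (h : IsCohenMacaulay A)
    (hdim : ringKrullDim A = 1) : ∃ a ∈ maximalIdeal A, a ∈ A⁰ := by
  obtain ⟨rs, hrs, hreg, hlen⟩ := h
  rw [hdim] at hlen
  have h1 : rs.length = 1 := by exact_mod_cast hlen
  obtain ⟨a, rfl⟩ := List.length_eq_one_iff.1 h1
  refine ⟨a, hrs a (by simp), ?_⟩
  have := ((RingTheory.Sequence.isWeaklyRegular_cons_iff A a []).1 hreg.1).1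
  rw [mem_nonZeroDivisors_iff_right]
  intro y hy
  apply this
  simpa [mul_comm] using hy

theorem IsReduction.exists_pow_le {x : A} (h : IsReduction (Ideal.span {x}) (maximalIdeal A)) :
    ∃ n : ℕ, maximalIdeal A ^ n ≤ Ideal.span {x} := by
  obtain ⟨n, hn⟩ := h.2
  exact ⟨n + 1, hn ▸ Ideal.mul_le_left⟩

theorem IsReduction.mem_nonZeroDivisors {x : A}
    (h : IsReduction (Ideal.span {x}) (maximalIdeal A)) (hCM : IsCohenMacaulay A)
    (hdim : ringKrullDim A = 1) : x ∈ A⁰ := by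
  obtain ⟨a, ha, hreg⟩ := hCM.exists_mem_nonZeroDivisors hdim
  obtain ⟨n, hn⟩ := h.exists_pow_le
  obtain ⟨c, hc⟩ := Ideal.mem_span_singleton'.1 (hn (Ideal.pow_mem_pow ha n))
  have := pow_mem hreg n
  rw [← hc, mul_mem_nonZeroDivisors] at this
  exact this.2

variable [IsNoetherianRing A]

theorem coe_hilbertFunction (n : ℕ) : (hilbertFunction A n : ℕ∞) =
    relLength (maximalIdeal A ^ n) (maximalIdeal A ^ (n + 1)) := by
  refine ENat.natCast_toNat fun h => ?_
  have h1 := relLength_add_length (Ideal.pow_le_pow_right (I := maximalIdeal A) n.le_succ)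
  rw [h, top_add] at h1
  exact length_quotient_ne_top le_rfl h1.symm

/-- λ(A/x𝔪ⁿ) is computed once through 𝔪ⁿ⁺¹ and 𝔪ⁿ, and once by regularity as λ(A/𝔪ⁿ) + λ(A/xA); the
finite λ(A/𝔪ⁿ) cancels. -/
theorem hilbertFunction_add_relLength {x : A} (hreg : x ∈ A⁰)
    (h : IsReduction (Ideal.span {x}) (maximalIdeal A)) (n : ℕ) :
    hilbertFunction A n +
        relLength (maximalIdeal A ^ (n + 1)) (Ideal.span {x} * maximalIdeal A ^ n) =
      Module.length A (A ⧸ Ideal.span {x}) := by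
  have hle : Ideal.span {x} * maximalIdeal A ^ n ≤ maximalIdeal A ^ (n + 1) := by
    rw [pow_succ']; exact Ideal.mul_mono_left h.1
  have h1 := relLength_add_length (Ideal.pow_le_pow_right (I := maximalIdeal A) n.le_succ)
  have h2 := relLength_add_length hle
  rw [length_quotient_span_singleton_mul hreg, ← h1, ← coe_hilbertFunction] at h2
  obtain ⟨N, hN⟩ := h.exists_pow_le
  have f1 := length_quotient_ne_top hN
  have f2 : Module.length A (A ⧸ maximalIdeal A ^ n) ≠ ⊤ := length_quotient_ne_top le_rfl
  generalize relLength (maximalIdeal A ^ (n + 1)) (Ideal.span {x} * maximalIdeal A ^ n) = u at *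
  generalize Module.length A (A ⧸ maximalIdeal A ^ n) = v at *
  generalize Module.length A (A ⧸ Ideal.span {x}) = w at *
  lift v to ℕ using f2
  lift w to ℕ using f1
  induction u using ENat.recTopCoe with
  | top => simp only [top_add] at h2; exact absurd h2.symm (by exact_mod_cast ENat.natCast_ne_top _)
  | coe u =>
    norm_cast at h2 ⊢
    omega

theorem coe_ringMultiplicity {x : A} (hreg : x ∈ A⁰)
    (h : IsReduction (Ideal.span {x}) (maximalIdeal A)) :
    (ringMultiplicity A : ℕ∞) = Module.length A (A ⧸ Ideal.span {x}) := by
  obtain ⟨N, hN⟩ := h.exists_pow_le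
  have f1 := length_quotient_ne_top hN
  obtain ⟨e, he⟩ := ENat.ne_top_iff_exists.1 f1
  rw [← he, Nat.cast_inj]
  obtain ⟨M, hM⟩ := h.eventually_eq
  have hH : ∀ n, M ≤ n → hilbertFunction A n = e := by
    intro n hn
    have := hilbertFunction_add_relLength hreg h n
    rw [relLength_eq_zero (hM n hn).le, add_zero, ← he] at this
    exact_mod_cast this
  have huniq : {e : ℕ | ∃ ρ : ℤ, ∀ᶠ n : ℕ in Filter.atTop,
      ((∑ i ∈ Finset.range (n + 1), hilbertFunction A i : ℕ) : ℤ) = e * (n + 1) - ρ} = {e} := by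
    ext e'
    simp only [Set.mem_ofPred_eq, Set.mem_singleton_iff]
    constructor
    · rintro ⟨ρ, hρ⟩
      obtain ⟨K, hK⟩ := Filter.eventually_atTop.1 hρ
      -- The difference of two consecutive large sums recovers the leading coefficient, so the set
      -- defining the multiplicity is a singleton.
      have h1 := hK (K + M) (by omega)
      have h2 := hK (K + M + 1) (by omega)
      rw [Finset.sum_range_succ, hH (K + M + 1) (by omega)] at h2
      push_cast at h1 h2
      have : (e : ℤ) = e' := by linear_combination h2 - h1
      exact_mod_cast this.symm
    · rintro rfl
      refine ⟨e' * (M + 1) - (∑ i ∈ Finset.range (M + 1), hilbertFunction A i : ℕ),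
        Filter.eventually_atTop.2 ⟨M, fun n hn => ?_⟩⟩
      induction n, hn using Nat.le_induction with
      | base => ring
      | succ n hn ih =>
        rw [Finset.sum_range_succ, hH (n + 1) (by omega)]
        push_cast at ih ⊢
        linear_combination ih
  rw [ringMultiplicity, huniq, csInf_singleton]

theorem hilbertFunction_eq_ringMultiplicity_iff {x : A} (hreg : x ∈ A⁰)
    (h : IsReduction (Ideal.span {x}) (maximalIdeal A)) (n : ℕ) :
    hilbertFunction A n = ringMultiplicity A ↔
      maximalIdeal A ^ (n + 1) = Ideal.span {x} * maximalIdeal A ^ n := by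
  have hle : Ideal.span {x} * maximalIdeal A ^ n ≤ maximalIdeal A ^ (n + 1) := by
    rw [pow_succ']; exact Ideal.mul_mono_left h.1
  have h1 := hilbertFunction_add_relLength hreg h n
  rw [← coe_ringMultiplicity hreg h] at h1
  constructor
  · intro h2
    rw [h2] at h1
    have h3 : relLength (maximalIdeal A ^ (n + 1)) (Ideal.span {x} * maximalIdeal A ^ n) = 0 := by
      generalize relLength (maximalIdeal A ^ (n + 1)) (Ideal.span {x} * maximalIdeal A ^ n) = u at *
      induction u using ENat.recTopCoe with
      | top => simp at h1
      | coe u => norm_cast at h1 ⊢; omega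
    rw [relLength, Module.length_eq_zero_iff, Submodule.Quotient.subsingleton_iff,
      Submodule.submoduleOf_eq_top] at h3
    exact le_antisymm h3 hle
  · intro h2
    rw [relLength_eq_zero h2.le, add_zero] at h1
    exact_mod_cast h1

/-- The least exponent may be attained by another generator `y`; it transfers to `x` through H(n) =
e, which mentions neither. -/
theorem pow_succ_eq_iff_reductionNumber_le (hdim : ringKrullDim A = 1) (hCM : IsCohenMacaulay A)
    {x : A} (hx : GeneratesMinimalReduction x) (n : ℕ) :
    maximalIdeal A ^ (n + 1) = Ideal.span {x} * maximalIdeal A ^ n ↔ reductionNumber A ≤ n := by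
  have key : ∀ y : A, GeneratesMinimalReduction y → ∀ m, hilbertFunction A m = ringMultiplicity A ↔
      maximalIdeal A ^ (m + 1) = Ideal.span {y} * maximalIdeal A ^ m := fun y hy m =>
    hilbertFunction_eq_ringMultiplicity_iff (hy.prop.mem_nonZeroDivisors hCM hdim) hy.prop m
  refine ⟨fun h => Nat.sInf_le ⟨x, hx, h⟩, fun h => ?_⟩
  have hne : {n : ℕ | ∃ x : A, GeneratesMinimalReduction x ∧
      maximalIdeal A ^ (n + 1) = Ideal.span {x} * maximalIdeal A ^ n}.Nonempty := by
    obtain ⟨N, hN⟩ := hx.prop.2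
    exact ⟨N, x, hx, hN.symm⟩
  obtain ⟨y, hy, hy'⟩ := Nat.sInf_mem hne
  have h0 := (key x hx _).1 ((key y hy _).2 hy')
  change maximalIdeal A ^ (reductionNumber A + 1) =
    Ideal.span {x} * maximalIdeal A ^ reductionNumber A at h0
  obtain ⟨k, rfl⟩ := Nat.exists_eq_add_of_le h
  rw [pow_add _ (reductionNumber A), ← mul_assoc, ← h0, ← pow_add]
  congr 1; omega

/-- The structure of the powers of the maximal ideal in almost minimal multiplicity. -/
theorem HasAlmostMinimalMultiplicity.exists_generator (h : HasAlmostMinimalMultiplicity A) {x : A}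
    (hreg : x ∈ A⁰) (hx : IsReduction (Ideal.span {x}) (maximalIdeal A)) :
    ∃ y ∈ maximalIdeal A, ∃ z ∈ maximalIdeal A, ∀ n : ℕ, 1 ≤ n →
      maximalIdeal A ^ (n + 1) = Ideal.span {x} * maximalIdeal A ^ n ⊔ Ideal.span {y ^ n * z} ∧
      ∀ a ∈ maximalIdeal A, a * (y ^ n * z) ∈ Ideal.span {x} * maximalIdeal A ^ n := by
  have hle : Ideal.span {x} * maximalIdeal A ^ 1 ≤ maximalIdeal A ^ 2 := by
    rw [pow_succ' _ 1]; exact Ideal.mul_mono_left hx.1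
  have h1 := hilbertFunction_add_relLength hreg hx 1
  rw [← coe_ringMultiplicity hreg hx, h, embeddingDimension, Nat.cast_add] at h1
  -- H(1) = b and the sum is b + 1, so λ(𝔪²/x𝔪) = 1. Products generate 𝔪², hence one product yz
  -- already generates it modulo x𝔪.
  have h2 : relLength (maximalIdeal A ^ (1 + 1)) (Ideal.span {x} * maximalIdeal A ^ 1) = 1 :=
    ENat.add_right_injective_of_ne_top (ENat.natCast_ne_top _) h1
  have hcov := (relLength_eq_one_iff hle).1 h2
  obtain ⟨y, hy, z, hz, hyz⟩ : ∃ y ∈ maximalIdeal A, ∃ z ∈ maximalIdeal A,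
      y * z ∉ Ideal.span {x} * maximalIdeal A ^ 1 := by
    by_contra! hcon
    refine hcov.lt.not_ge ?_
    rw [pow_two, Ideal.mul_le]
    exact hcon
  have hmem : y * z ∈ maximalIdeal A ^ 2 := by rw [pow_two]; exact Ideal.mul_mem_mul hy hz
  have hsq : maximalIdeal A ^ 2 = Ideal.span {x} * maximalIdeal A ^ 1 ⊔ Ideal.span {y * z} := by
    refine ((hcov.eq_or_eq le_sup_left (sup_le hle ?_)).resolve_left fun h' => hyz ?_).symm
    · exact (Ideal.span_singleton_le_iff_mem _).2 hmem
    · rw [← h']; exact Ideal.mem_sup_right (Ideal.mem_span_singleton_self _)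
  refine ⟨y, hy, z, hz, fun n hn => ?_⟩
  induction n, hn using Nat.le_induction with
  | base =>
    rw [pow_one y]
    exact ⟨hsq, fun a ha => smul_mem_of_covBy (IsNoetherian.noetherian _) hcov ha hmem⟩
  | succ n hn ih =>
    obtain ⟨ih1, ih2⟩ := ih
    have hx1 : ∀ u ∈ maximalIdeal A, ∀ v ∈ Ideal.span {x} * maximalIdeal A ^ n,
        u * v ∈ Ideal.span {x} * maximalIdeal A ^ (n + 1) := by
      intro u hu v hv
      rw [pow_succ', ← mul_assoc, mul_comm (Ideal.span {x}), mul_assoc]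
      exact Ideal.mul_mem_mul hu hv
    have hx2 : ∀ a ∈ maximalIdeal A,
        a * (y ^ (n + 1) * z) ∈ Ideal.span {x} * maximalIdeal A ^ (n + 1) := by
      intro a ha
      rw [show a * (y ^ (n + 1) * z) = y * (a * (y ^ n * z)) by ring]
      exact hx1 y hy _ (ih2 a ha)
    refine ⟨le_antisymm ?_ (sup_le ?_ ?_), hx2⟩
    · rw [pow_succ' _ (n + 1), Ideal.mul_le]
      intro a ha u hu
      rw [ih1] at hu
      obtain ⟨v, hv, w, hw, rfl⟩ := Submodule.mem_sup.1 hu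
      obtain ⟨c, rfl⟩ := Ideal.mem_span_singleton'.1 hw
      rw [mul_add]
      refine Ideal.add_mem _ (Ideal.mem_sup_left (hx1 a ha v hv)) ?_
      -- Writing az = xs + d·yz and multiplying by yⁿ turns a·yⁿz into an element of x𝔪ⁿ⁺¹ plus a
      -- multiple of yⁿ⁺¹z.
      have haz : a * z ∈ maximalIdeal A ^ 2 := by rw [pow_two]; exact Ideal.mul_mem_mul ha hz
      rw [hsq] at haz
      obtain ⟨p, hp, q, hq, hpq⟩ := Submodule.mem_sup.1 haz
      obtain ⟨d, rfl⟩ := Ideal.mem_span_singleton'.1 hq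
      obtain ⟨s, hs, rfl⟩ := Ideal.mem_span_singleton_mul.1 hp
      rw [show a * (c * (y ^ n * z)) = x * (c * (y ^ n * s)) + (c * d) * (y ^ (n + 1) * z) by
        linear_combination (-(c * y ^ n)) * hpq]
      refine Ideal.add_mem _ (Ideal.mem_sup_left ?_) (Ideal.mem_sup_right ?_)
      · refine Ideal.mul_mem_mul (Ideal.mem_span_singleton_self x) (Ideal.mul_mem_left _ _ ?_)
        rw [pow_succ]
        exact Ideal.mul_mem_mul (Ideal.pow_mem_pow hy n) (by rwa [pow_one] at hs)
      · exact Ideal.mul_mem_left _ _ (Ideal.mem_span_singleton_self _)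
    · rw [pow_succ' _ (n + 1)]; exact Ideal.mul_mono_left hx.1
    · rw [Ideal.span_singleton_le_iff_mem, pow_succ]
      exact Ideal.mul_mem_mul (Ideal.pow_mem_pow hy _) hz

end Reduction

/-! ### Apery invariants and micro-invariants. -/

section Apery

variable {A : Type*} [CommRing A] [IsLocalRing A] [IsNoetherianRing A]

/-- Otherwise, for N large, 𝔪ᴺ⁺ⁿ = xⁿ𝔪ᴺ lies in 𝔪ᴺ⁺ⁿ⁺¹, and Nakayama makes it zero although it
contains the regular element xᴺ⁺ⁿ. -/
theorem IsReduction.pow_notMem_pow {x : A} (hreg : x ∈ A⁰)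
    (h : IsReduction (Ideal.span {x}) (maximalIdeal A)) (n : ℕ) :
    x ^ n ∉ maximalIdeal A ^ (n + 1) := by
  intro hn
  obtain ⟨N, hN⟩ := h.eventually_eq
  have hpow : ∀ k, maximalIdeal A ^ (N + k) = Ideal.span {x} ^ k * maximalIdeal A ^ N := by
    intro k
    induction k with
    | zero => simp
    | succ k ih => rw [← add_assoc, hN _ (by omega), ih, pow_succ', mul_assoc]
  have hle : maximalIdeal A ^ (N + n) ≤ maximalIdeal A • maximalIdeal A ^ (N + n) := by
    rw [smul_eq_mul, ← pow_succ']
    nth_rewrite 1 [hpow n]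
    rw [Ideal.span_singleton_pow, show N + n + 1 = (n + 1) + N by ring, pow_add _ (n + 1)]
    exact Ideal.mul_mono_left ((Ideal.span_singleton_le_iff_mem _).2 hn)
  have h0 := Submodule.eq_bot_of_le_smul_of_le_jacobson_bot _ _
    (IsNoetherian.noetherian (maximalIdeal A ^ (N + n))) hle (maximalIdeal_le_jacobson _)
  have hxm : x ∈ maximalIdeal A := h.1 (Ideal.mem_span_singleton_self x)
  have := Ideal.pow_mem_pow hxm (N + n)
  rw [h0, Ideal.mem_bot] at this
  exact nonZeroDivisors.ne_zero (pow_mem hreg _) this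

theorem aperyInvariant_eq {x : A} (hreg : x ∈ A⁰)
    (hx : IsReduction (Ideal.span {x}) (maximalIdeal A)) (h : HasAlmostMinimalMultiplicity A)
    (h2 : maximalIdeal A ^ 2 ≠ Ideal.span {x} * maximalIdeal A) :
    aperyInvariant x 1 + 2 = ringMultiplicity A ∧ aperyInvariant x 2 = 1 ∧
      (∀ i, 3 ≤ i → aperyInvariant x i = 0) ∧ maximalIdeal A ^ 3 ≤ Ideal.span {x} := by
  obtain ⟨y, hy, z, hz, hyz⟩ := h.exists_generator hreg hx
  obtain ⟨h11, h12⟩ := hyz 1 le_rfl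
  obtain ⟨h21, -⟩ := hyz 2 (by omega)
  simp only [pow_one, Nat.reduceAdd] at h11 h12 h21
  have hxm : x ∈ maximalIdeal A := hx.1 (Ideal.mem_span_singleton_self x)
  have h3 : maximalIdeal A ^ 3 ≤ Ideal.span {x} := by
    rw [h21]
    refine sup_le Ideal.mul_le_left ((Ideal.span_singleton_le_iff_mem _).2 ?_)
    rw [show y ^ 2 * z = y * (y * z) by ring]
    exact Ideal.mul_le_left (h12 y hy)
  have hnot : y * z ∉ Ideal.span {x} := by
    intro hmem
    obtain ⟨c, hc⟩ := Ideal.mem_span_singleton'.1 hmem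
    -- In yz = cx, a unit `c` would put `x` in 𝔪², while a nonunit would put yz in x𝔪 and force 𝔪² =
    -- x𝔪.
    by_cases hu : IsUnit c
    · obtain ⟨c, rfl⟩ := hu
      refine hx.pow_notMem_pow hreg 1 ?_
      rw [pow_one, show x = ↑c⁻¹ * (y * z) by rw [← hc, Units.inv_mul_cancel_left], pow_two]
      exact Ideal.mul_mem_left _ _ (Ideal.mul_mem_mul hy hz)
    · refine h2 (h11.trans (sup_eq_left.2 ((Ideal.span_singleton_le_iff_mem _).2 ?_)))
      rw [← hc, mul_comm c x]
      exact Ideal.mul_mem_mul (Ideal.mem_span_singleton_self x) hu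
  have hcov : Ideal.span {x} ⋖ maximalIdeal A ^ 2 ⊔ Ideal.span {x} := by
    have := covBy_sup_span_singleton (N := Ideal.span {x}) (w := y * z)
      (fun a ha => Ideal.mul_le_left (h12 a ha)) hnot
    convert this using 1
    rw [h11]
    refine le_antisymm (sup_le (sup_le (Ideal.mul_le_left.trans le_sup_left) le_sup_right)
      le_sup_left) (sup_le le_sup_right (le_sup_right.trans le_sup_left))
  have hge : ∀ i, 3 ≤ i → maximalIdeal A ^ i ⊔ Ideal.span {x} = Ideal.span {x} := fun i hi =>
    sup_eq_right.2 ((Ideal.pow_le_pow_right hi).trans h3)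
  have g2 : aperyInvariant x 2 = 1 := by
    rw [aperyInvariant, hge _ le_rfl]
    exact (relLength_eq_one_iff hcov.le).2 hcov
  refine ⟨?_, g2, fun i hi => ?_, h3⟩
  -- The chain A ⊇ 𝔪 ⊇ 𝔪² + xA ⊇ xA gives e = 1 + γ₁ + γ₂.
  · have e1 := relLength_add_length (P := A) (M := maximalIdeal A ^ 1 ⊔ Ideal.span {x})
      (N := maximalIdeal A ^ (1 + 1) ⊔ Ideal.span {x})
      (sup_le_sup_right (Ideal.pow_le_pow_right (by omega)) _)
    have e2 := relLength_add_length (P := A) (M := maximalIdeal A ^ 2 ⊔ Ideal.span {x})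
      (N := maximalIdeal A ^ (2 + 1) ⊔ Ideal.span {x})
      (sup_le_sup_right (Ideal.pow_le_pow_right (by omega)) _)
    have e3 : Module.length A (A ⧸ maximalIdeal A ^ 1 ⊔ Ideal.span {x}) = 1 := by
      rw [pow_one, sup_eq_left.2 hx.1, Module.length_eq_one_iff, isSimpleModule_iff_isCoatom]
      exact (maximalIdeal.isMaximal A).out
    rw [coe_ringMultiplicity hreg hx, ← hge (2 + 1) (by omega), ← e2, ← e1, e3]
    change aperyInvariant x 1 + 2 = aperyInvariant x 2 + (aperyInvariant x 1 + 1)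
    rw [g2]; ring
  · rw [aperyInvariant, hge i hi, hge (i + 1) (by omega)]
    exact relLength_eq_zero le_rfl

omit [IsNoetherianRing A] in
theorem neighborhoodFiltration_eq_one {x : A} (hreg : x ∈ A⁰)
    (hxm : x ∈ maximalIdeal A) {i : ℕ}
    (hr : ∀ n, i + 1 ≤ n → maximalIdeal A ^ (n + 1) = Ideal.span {x} * maximalIdeal A ^ n)
    (hle : maximalIdeal A ^ (i + 1) ≤ Ideal.span {x}) :
    neighborhoodFiltration A i = 1 := by
  refine sup_eq_left.2 (Submodule.smul_le.2 ?_)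
  rintro p hp _ ⟨s, a, b, ⟨-, ha⟩, hb, rfl⟩
  obtain ⟨N, hN⟩ := Filter.eventually_atTop.1 ha
  have hpow : ∀ k, maximalIdeal A ^ (i + 1 + k) = Ideal.span {x ^ k} * maximalIdeal A ^ (i + 1) := by
    intro k
    induction k with
    | zero => simp
    | succ k ih =>
      rw [← add_assoc, hr _ (by omega), ih, ← mul_assoc, Ideal.span_singleton_mul_span_singleton,
        pow_succ' x]
  -- The factor xᴺ raises the degree until superficiality applies: `a` can be split off, then xᴺ,
  -- and the remaining factor in 𝔪ⁱ⁺¹ is divisible by `x`. Cancelling xᴺ⁺¹ shows that p·b/a lies in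
  -- A.
  have hmem : b * (x ^ N * (x * p)) ∈ maximalIdeal A ^ (i + 1 + N + s) := by
    rw [add_comm _ s, pow_add]
    refine Ideal.mul_mem_mul hb ?_
    rw [hpow]
    refine Ideal.mul_mem_mul (Ideal.mem_span_singleton_self _) ?_
    rw [pow_succ']
    exact Ideal.mul_mem_mul hxm hp
  rw [hN _ (by omega), hpow] at hmem
  obtain ⟨u, hu, hu'⟩ := Ideal.mem_span_singleton_mul.1 hmem
  obtain ⟨v, hv, rfl⟩ := Ideal.mem_span_singleton_mul.1 hu
  obtain ⟨w, rfl⟩ := Ideal.mem_span_singleton'.1 (hle hv)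
  have hbp : p * b = w * a := by
    have : x ^ N * x * (p * b) = x ^ N * x * (w * a) := by linear_combination -hu'
    exact (mul_cancel_left_mem_nonZeroDivisors (mul_mem (pow_mem hreg N) hreg)).1 this
  rw [IsLocalization.smul_mk', hbp, IsLocalization.mk'_mul_cancel_right]
  exact Submodule.mem_one.2 ⟨w, rfl⟩

end Apery

/-! ### Bases modulo a subspace, with dual functionals. -/

section VectorSpace

variable {k G : Type*} [Field k] [AddCommGroup G] [Module k G]

/-- A finite-dimensional subspace `E` has a basis modulo `L`, together with dual functionals
vanishing on `L`. -/
theorem exists_dual_basis_modulo (E L : Submodule k G) [FiniteDimensional k E] :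
    ∃ (n : ℕ) (b : Fin n → G) (ψ : Fin n → G →ₗ[k] k), (∀ l, b l ∈ E) ∧
      (∀ l, ∀ v ∈ L, ψ l v = 0) ∧ (∀ l, ψ l (b l) = 1) ∧ (∀ l l', l ≠ l' → ψ l (b l') = 0) ∧
      E ≤ Submodule.span k (Set.range b) ⊔ L ∧ (E ≤ L → n = 0) := by
  let Q := E.map L.mkQ
  let B := Module.finBasis k Q
  have hb : ∀ l, ∃ v ∈ E, L.mkQ v = B l := fun l => Submodule.mem_map.1 (B l).2
  choose b hbE hb using hb
  have hψ : ∀ l, ∃ f : (G ⧸ L) →ₗ[k] k, f ∘ₗ Q.subtype = B.coord l := fun l =>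
    LinearMap.exists_extend (B.coord l)
  choose f hf using hψ
  have hfb : ∀ l l', f l (L.mkQ (b l')) = B.coord l (B l') := by
    intro l l'
    rw [← hf, hb]; rfl
  refine ⟨Module.finrank k Q, b, fun l => f l ∘ₗ L.mkQ, hbE, fun l v hv => ?_, fun l => ?_,
    fun l l' hl => ?_, fun v hv => ?_, fun hEL => ?_⟩
  · simp [(Submodule.Quotient.mk_eq_zero L).2 hv]
  · simp only [LinearMap.comp_apply, hfb]; simp
  · simp only [LinearMap.comp_apply, hfb]; simp [hl.symm]
  · let q : Q := ⟨L.mkQ v, Submodule.mem_map_of_mem hv⟩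
    have hsum : ∑ l, B.repr q l • b l ∈ Submodule.span k (Set.range b) :=
      Submodule.sum_mem _ fun l _ => Submodule.smul_mem _ _ (Submodule.subset_span ⟨l, rfl⟩)
    refine Submodule.mem_sup.2 ⟨_, hsum, v - ∑ l, B.repr q l • b l, ?_, add_sub_cancel _ _⟩
    rw [← Submodule.Quotient.mk_eq_zero, ← Submodule.mkQ_apply, map_sub, map_sum, sub_eq_zero]
    have := congrArg Subtype.val (B.sum_repr q)
    rw [AddSubmonoidClass.coe_finsetSum] at this
    simp only [map_smul, hb]
    exact this.symm
  · have : Q = ⊥ := by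
      rw [eq_bot_iff, Submodule.map_le_iff_le_comap]
      exact hEL.trans L.ker_mkQ.ge
    rw [this]; simp

end VectorSpace

/-! ### Homogeneous generators sorted by degree and lifetime. -/

section Graded

variable {k F G : Type*} [Field k] [CommRing F] [Algebra k F] [AddCommGroup G] [Module k G]
  [Module F G] [IsScalarTower k F G] (X : F) (V : ℕ → Submodule k G)

theorem coe_sub_lt_of_lt_add {N d : ℕ} {l : ℕ∞} (hd : d ≤ N) (h : (N : ℕ∞) < d + l) :
    ((N - d : ℕ) : ℕ∞) < l := by
  induction l using ENat.recTopCoe with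
  | top => exact ENat.natCast_lt_top _
  | coe l => norm_cast at h ⊢; omega

theorem pow_smul_eq_zero_of_le {F G : Type*} [CommRing F] [AddCommGroup G] [Module F G] {X : F}
    {v : G} {n m : ℕ} (h : X ^ n • v = 0) (hnm : n ≤ m) : X ^ m • v = 0 := by
  rw [← Nat.sub_add_cancel hnm, pow_add, mul_smul, h, smul_zero]

/-- The elements of degree `i` killed by `X ^ n` for all `n ≥ j`. -/
def torsionUpTo (i : ℕ) (j : ℕ∞) : Submodule k G where
  carrier := {v | v ∈ V i ∧ ∀ n : ℕ, j ≤ n → X ^ n • v = 0}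
  add_mem' ha hb := ⟨add_mem ha.1 hb.1, fun n hn => by rw [smul_add, ha.2 n hn, hb.2 n hn, add_zero]⟩
  zero_mem' := ⟨zero_mem _, fun _ _ => smul_zero _⟩
  smul_mem' c v hv := ⟨Submodule.smul_mem _ c hv.1, fun n hn => by
    rw [smul_comm, hv.2 n hn, smul_zero]⟩

/-- The elements of degree `i` killed by `X ^ n` for some `n < j`. -/
def torsionBelow (i : ℕ) (j : ℕ∞) : Submodule k G where
  carrier := {v | v ∈ V i ∧ (v = 0 ∨ ∃ n : ℕ, (n : ℕ∞) < j ∧ X ^ n • v = 0)}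
  add_mem' := by
    rintro a b ⟨ha, ha'⟩ ⟨hb, hb'⟩
    refine ⟨add_mem ha hb, ?_⟩
    rcases ha' with rfl | ⟨n, hn, ha'⟩
    · simpa using hb'
    rcases hb' with rfl | ⟨m, hm, hb'⟩
    · exact Or.inr ⟨n, hn, by simpa using ha'⟩
    rcases le_total n m with h | h
    · exact Or.inr ⟨m, hm, by rw [smul_add, pow_smul_eq_zero_of_le ha' h, hb', add_zero]⟩
    · exact Or.inr ⟨n, hn, by rw [smul_add, pow_smul_eq_zero_of_le hb' h, ha', add_zero]⟩
  zero_mem' := ⟨zero_mem _, Or.inl rfl⟩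
  smul_mem' := by
    rintro c v ⟨hv, hv'⟩
    refine ⟨Submodule.smul_mem _ c hv, ?_⟩
    rcases hv' with rfl | ⟨n, hn, hv'⟩
    · simp
    · exact Or.inr ⟨n, hn, by rw [smul_comm, hv', smul_zero]⟩

/-- The elements of degree `i` divisible by `X`. -/
def multiplesOf : ℕ → Submodule k G
  | 0 => ⊥
  | i + 1 => (V i).map (Module.toModuleEnd k G X : G →ₗ[k] G)

variable {X V}

theorem mem_multiplesOf_succ {i : ℕ} {v : G} :
    v ∈ multiplesOf X V (i + 1) ↔ ∃ u ∈ V i, X • u = v := Iff.rfl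

theorem le_torsionUpTo_top {i : ℕ} : V i ≤ torsionUpTo X V i ⊤ :=
  fun v hv => ⟨hv, fun n hn => by simp at hn⟩

variable (hX : ∀ i, ∀ v ∈ V i, X • v ∈ V (i + 1))

include hX

omit [Algebra k F] [IsScalarTower k F G] in
theorem pow_smul_mem {i : ℕ} {v : G} (hv : v ∈ V i) (n : ℕ) : X ^ n • v ∈ V (i + n) := by
  induction n with
  | zero => simpa using hv
  | succ n ih => rw [pow_succ', mul_smul]; exact hX _ _ ih

variable {S : Type*} {deg : S → ℕ} {life : S → ℕ∞} {g : S → G}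

/-- A leading-term argument: in a relation of degree N, take the generator `s` with the
lexicographically largest pair (degree, lifetime). Every term is X^(N - deg s) times an element of
degree `deg s`, and `ψ s` sees only the term of `s`: generators of lower degree contribute multiples
of X, and those of shorter lifetime lie in `torsionBelow`. -/
theorem linearIndependent_pow_smul
    (hg : ∀ s, g s ∈ torsionUpTo X V (deg s) (life s)) (ψ : S → G →ₗ[k] k)
    (hψ : ∀ s, ∀ v ∈ torsionBelow X V (deg s) (life s) ⊔ multiplesOf X V (deg s), ψ s v = 0)
    (hψ1 : ∀ s, ψ s (g s) = 1)
    (hψ0 : ∀ s s', s ≠ s' → deg s = deg s' → life s = life s' → ψ s (g s') = 0) (N : ℕ) :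
    LinearIndependent k
      (fun s : {s // deg s ≤ N ∧ (N : ℕ∞) < deg s + life s} => X ^ (N - deg s.1) • g s.1) := by
  classical
  rw [linearIndependent_iff']
  intro T a ha
  by_contra! hcon
  let T' := T.filter fun s => a s ≠ 0
  have hT' : T'.Nonempty := by
    obtain ⟨s, hs, hs'⟩ := hcon
    exact ⟨s, Finset.mem_filter.2 ⟨hs, hs'⟩⟩
  obtain ⟨s, hs, hmax⟩ := T'.exists_max_image (fun s => toLex (deg s.1, life s.1)) hT'
  have hs0 : a s ≠ 0 := (Finset.mem_filter.1 hs).2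
  have ha' : ∑ t ∈ T', a t • X ^ (N - deg t.1) • g t.1 = 0 := by
    rw [← ha]
    refine Finset.sum_subset (Finset.filter_subset _ _) fun t ht ht' => ?_
    have : a t = 0 := by simpa [T', ht] using ht'
    rw [this, zero_smul]
  obtain ⟨⟨s, hsN, hsN'⟩, rfl⟩ : ∃ s', s = s' := ⟨s, rfl⟩
  dsimp only at hmax
  set L := torsionBelow X V (deg s) (life s) ⊔ multiplesOf X V (deg s) with hL
  -- each term is `X ^ (N - deg s)` times an element on which `ψ s` is known
  have hterm : ∀ t ∈ T', ∃ u ∈ V (deg s), X ^ (N - deg t.1) • g t.1 = X ^ (N - deg s) • u ∧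
      ψ s u = if t.1 = s then 1 else 0 := by
    rintro ⟨t, htN, htN'⟩ ht
    have h := hmax _ ht
    dsimp only at h ⊢
    rw [Prod.Lex.toLex_le_toLex] at h
    rcases h with h | ⟨h, h'⟩
    · dsimp only at h
      refine ⟨X ^ (deg s - deg t) • g t, ?_, ?_, ?_⟩
      · have := pow_smul_mem hX (hg t).1 (deg s - deg t)
        rwa [Nat.add_sub_cancel' h.le] at this
      · rw [smul_smul, ← pow_add]; congr 2; omega
      · rw [if_neg (by rintro rfl; omega)]
        refine hψ s _ (Submodule.mem_sup_right ?_)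
        obtain ⟨d, hd⟩ : ∃ d, deg s = deg t + d + 1 := ⟨deg s - deg t - 1, by omega⟩
        rw [hd, mem_multiplesOf_succ]
        refine ⟨X ^ d • g t, pow_smul_mem hX (hg t).1 d, ?_⟩
        rw [smul_smul, ← pow_succ']; congr 2; omega
    · dsimp only at h h'
      refine ⟨g t, h ▸ (hg t).1, by rw [h], ?_⟩
      split_ifs with hts
      · rw [hts, hψ1]
      rcases h'.eq_or_lt with h' | h'
      · exact hψ0 s t (Ne.symm hts) h.symm h'.symm
      · refine hψ s _ (Submodule.mem_sup_left ⟨h ▸ (hg t).1, Or.inr ?_⟩)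
        obtain ⟨n, hn⟩ := ENat.ne_top_iff_exists.1 h'.ne_top
        exact ⟨n, hn ▸ h', (hg t).2 n hn.ge⟩
  choose! u huV hu huψ using hterm
  have hker : X ^ (N - deg s) • ∑ t ∈ T', a t • u t = 0 := by
    rw [← ha', Finset.smul_sum]
    exact Finset.sum_congr rfl fun t ht => by rw [smul_comm, hu t ht]
  -- The sum dies under X^(N - deg s), and N - deg s is less than the lifetime of `s`, so `ψ s`
  -- kills it; what is left says `a s = 0`.
  have hmem : ∑ t ∈ T', a t • u t ∈ torsionBelow X V (deg s) (life s) := by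
    exact ⟨Submodule.sum_mem _ fun t ht => Submodule.smul_mem _ _ (huV t ht),
      Or.inr ⟨N - deg s, coe_sub_lt_of_lt_add hsN hsN', hker⟩⟩
  have hz := hψ s _ (Submodule.mem_sup_left hmem)
  rw [map_sum, Finset.sum_eq_single_of_mem _ hs, map_smul, huψ _ hs] at hz
  · simp at hz; exact hs0 hz
  · rintro ⟨t, ht'⟩ ht hne
    rw [map_smul, huψ _ ht, if_neg (by rintro rfl; exact hne rfl), smul_zero]

omit hX in
-- Induction on the degree, then well-founded induction on the lifetime: modulo the generators an
-- element is a sum of a shorter-lived one and a multiple of X. Passing to the next degree, a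
-- generator whose lifetime has expired contributes zero.
theorem torsionUpTo_le_span
    (hg : ∀ s, g s ∈ torsionUpTo X V (deg s) (life s))
    (hspan : ∀ i j, torsionUpTo X V i j ≤ Submodule.span k {v | ∃ s, deg s = i ∧ life s = j ∧ g s = v} ⊔
      (torsionBelow X V i j ⊔ multiplesOf X V i)) (N : ℕ) (j : ℕ∞) :
    torsionUpTo X V N j ≤ Submodule.span k (Set.range
      (fun s : {s // deg s ≤ N ∧ (N : ℕ∞) < deg s + life s} => X ^ (N - deg s.1) • g s.1)) := by
  induction N using Nat.strong_induction_on generalizing j with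
  | _ N ihN =>
  induction j using WellFoundedLT.induction with
  | _ j ihj =>
  refine (hspan N j).trans (sup_le (Submodule.span_le.2 ?_) (sup_le ?_ ?_))
  · rintro _ ⟨s, rfl, rfl, rfl⟩
    by_cases h : life s = 0
    · have := (hg s).2 0 h.le
      rw [pow_zero, one_smul] at this
      rw [this]; exact zero_mem _
    · refine Submodule.subset_span ⟨⟨s, le_rfl, ?_⟩, by simp⟩
      generalize life s = l at *
      induction l using ENat.recTopCoe with
      | top => simp
      | coe l => norm_cast at h ⊢; omega
  · rintro v ⟨hv, rfl | ⟨n, hn, hv'⟩⟩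
    · exact zero_mem _
    · refine ihj n hn ⟨hv, fun m hm => ?_⟩
      exact pow_smul_eq_zero_of_le hv' (ENat.natCast_le_natCast.1 hm)
  · cases N with
    | zero => exact bot_le
    | succ N =>
      have h2 := le_torsionUpTo_top.trans (ihN N (by omega) ⊤)
      refine (Submodule.map_mono h2).trans ?_
      rw [Submodule.map_span, Submodule.span_le]
      rintro _ ⟨_, ⟨⟨s, hs, hs'⟩, rfl⟩, rfl⟩
      change X • X ^ (N - deg s) • g s ∈ _
      rw [smul_smul, ← pow_succ', show N - deg s + 1 = N + 1 - deg s by omega]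
      by_cases h : ((N + 1 : ℕ) : ℕ∞) < deg s + life s
      · exact Submodule.subset_span ⟨⟨s, by omega, h⟩, rfl⟩
      · rw [(hg s).2]
        · exact zero_mem _
        · clear hs'
          generalize life s = l at *
          induction l using ENat.recTopCoe with
          | top => exact absurd (ENat.natCast_lt_top _) h
          | coe l => norm_cast at h ⊢; omega

end Graded

/-! ### Direct sums of cyclic modules. -/

section CyclicSum

variable {F : Type*} [CommRing F] {I J : Type*} [DecidableEq I] [DecidableEq J]

/-- A direct sum of copies of `F` and of modules `F / X ^ ℓ`. -/
abbrev CyclicSum (X : F) (I : Type*) {J : Type*} (ℓ : J → ℕ) : Type _ :=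
  (⨁ _ : I, F) × (⨁ t : J, F ⧸ Ideal.span {X ^ ℓ t})

/-- The generators of the cyclic summands. -/
def CyclicSum.gen (X : F) (ℓ : J → ℕ) : I ⊕ J → CyclicSum X I ℓ
  | Sum.inl t => (DirectSum.of (fun _ : I => F) t 1, 0)
  | Sum.inr t => (0, DirectSum.of (fun t : J => F ⧸ Ideal.span {X ^ ℓ t}) t 1)

variable (X : F) (ℓ : J → ℕ)

theorem CyclicSum.smul_gen_inl (f : F) (t : I) : f • CyclicSum.gen X ℓ (Sum.inl t : I ⊕ J) =
    (DirectSum.of (fun _ : I => F) t f, 0) := by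
  refine Prod.ext ?_ (smul_zero f)
  change f • DirectSum.lof F I (fun _ => F) t 1 = DirectSum.lof F I (fun _ => F) t f
  rw [← map_smul, smul_eq_mul, mul_one]

theorem CyclicSum.smul_gen_inr (f : F) (t : J) : f • CyclicSum.gen X ℓ (Sum.inr t : I ⊕ J) =
    (0, DirectSum.of (fun t : J => F ⧸ Ideal.span {X ^ ℓ t}) t (Ideal.Quotient.mk _ f)) := by
  refine Prod.ext (smul_zero f) ?_
  change f • DirectSum.lof F J (fun t : J => F ⧸ Ideal.span {X ^ ℓ t}) t 1 =
    DirectSum.lof F J (fun t : J => F ⧸ Ideal.span {X ^ ℓ t}) t (Ideal.Quotient.mk _ f)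
  rw [← map_smul, Algebra.smul_def, mul_one]
  rfl

theorem CyclicSum.pow_smul_gen_inr {n : ℕ} {t : J} (h : ℓ t ≤ n) :
    X ^ n • CyclicSum.gen X ℓ (Sum.inr t : I ⊕ J) = 0 := by
  rw [CyclicSum.smul_gen_inr, Ideal.Quotient.eq_zero_iff_mem.2, map_zero]
  · rfl
  · exact Ideal.mem_span_singleton.2 (pow_dvd_pow X h)

theorem CyclicSum.span_gen :
    Submodule.span F (Set.range (CyclicSum.gen X ℓ : I ⊕ J → CyclicSum X I ℓ)) = ⊤ := by
  have hmem : ∀ (f : F) (s : I ⊕ J), f • CyclicSum.gen X ℓ s ∈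
      Submodule.span F (Set.range (CyclicSum.gen X ℓ : I ⊕ J → CyclicSum X I ℓ)) := fun f s =>
    Submodule.smul_mem _ _ (Submodule.subset_span ⟨s, rfl⟩)
  rw [eq_top_iff]
  rintro ⟨v, w⟩ -
  have hv : ∀ v, ((v, 0) : CyclicSum X I ℓ) ∈
      Submodule.span F (Set.range (CyclicSum.gen X ℓ : I ⊕ J → CyclicSum X I ℓ)) := by
    intro v
    induction v using DirectSum.induction_on with
    | zero => exact zero_mem _
    | add a b ha hb => simpa using add_mem ha hb
    | of t f => exact CyclicSum.smul_gen_inl (J := J) X ℓ f t ▸ hmem f (Sum.inl t)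
  have hw : ∀ w, ((0, w) : CyclicSum X I ℓ) ∈
      Submodule.span F (Set.range (CyclicSum.gen X ℓ : I ⊕ J → CyclicSum X I ℓ)) := by
    intro w
    induction w using DirectSum.induction_on with
    | zero => exact zero_mem _
    | add a b ha hb => simpa using add_mem ha hb
    | of t f =>
      obtain ⟨f, rfl⟩ := Ideal.Quotient.mk_surjective f
      exact CyclicSum.smul_gen_inr (I := I) X ℓ f t ▸ hmem f (Sum.inr t)
  simpa using add_mem (hv v) (hw w)

variable {X ℓ} in
theorem CyclicSum.exists_lift {G : Type*} [AddCommGroup G] [Module F G] (g : I ⊕ J → G)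
    (hg : ∀ t, X ^ ℓ t • g (Sum.inr t) = 0) :
    ∃ φ : CyclicSum X I ℓ →ₗ[F] G, ∀ s, φ (CyclicSum.gen X ℓ s) = g s := by
  have hle : ∀ t, Ideal.span {X ^ ℓ t} ≤
      LinearMap.ker (LinearMap.toSpanSingleton F G (g (Sum.inr t))) := fun t => by
    rw [Ideal.span, Submodule.span_singleton_le_iff_mem, LinearMap.mem_ker]
    exact hg t
  refine ⟨LinearMap.coprod
    (DirectSum.toModule F _ _ fun t => LinearMap.toSpanSingleton F G (g (Sum.inl t)))
    (DirectSum.toModule F _ _ fun t => Submodule.liftQ (Ideal.span {X ^ ℓ t}) _ (hle t)), ?_⟩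
  rintro (t | t)
  · rw [CyclicSum.gen, LinearMap.coprod_apply, map_zero, add_zero, ← DirectSum.lof_eq_of F,
      DirectSum.toModule_lof, LinearMap.toSpanSingleton_apply, one_smul]
  · rw [CyclicSum.gen, LinearMap.coprod_apply, map_zero, zero_add, ← DirectSum.lof_eq_of F,
      DirectSum.toModule_lof]
    exact one_smul F _

variable {X ℓ} in
-- Since every torsion exponent is at least one, each cyclic summand maps onto F/X. These
-- coordinates show that the generators stay independent modulo X.
theorem CyclicSum.exists_coord (hℓ : ∀ t, 1 ≤ ℓ t) (s : I ⊕ J) :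
    ∃ p : CyclicSum X I ℓ →ₗ[F] F ⧸ Ideal.span {X}, p (CyclicSum.gen X ℓ s) = 1 ∧
      ∀ s', s ≠ s' → p (CyclicSum.gen X ℓ s') = 0 := by
  obtain ⟨p, hp⟩ := CyclicSum.exists_lift (X := X) (ℓ := ℓ)
    (fun s' : I ⊕ J => if s = s' then (1 : F ⧸ Ideal.span {X}) else 0) (by
      intro t
      split_ifs
      · rw [Algebra.smul_def, mul_one]
        refine Ideal.Quotient.eq_zero_iff_mem.2 (Ideal.mem_span_singleton.2 ?_)
        exact dvd_pow_self X (by have := hℓ t; omega)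
      · exact smul_zero _)
  exact ⟨p, by rw [hp, if_pos rfl], fun s' h => by rw [hp, if_neg h]⟩

end CyclicSum

/-! ### Existence of graded decompositions and counting of generators. -/

section Decomposition

variable {k F G : Type*} [Field k] [CommRing F] [Algebra k F] [AddCommGroup G] [Module k G]
  [Module F G] [IsScalarTower k F G] {X : F} {V : ℕ → Submodule k G}

/-- The surviving multiples of the generators span M over k, and φ carries them to a k-basis of G
assembled degree by degree. -/
theorem bijective_of_generators (hV : DirectSum.IsInternal V)
    (hX : ∀ i, ∀ v ∈ V i, X • v ∈ V (i + 1))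
    (hF : Submodule.span k (Set.range fun n : ℕ => X ^ n) = ⊤)
    {S : Type*} {deg : S → ℕ} {life : S → ℕ∞} {g : S → G}
    (hg : ∀ s, g s ∈ torsionUpTo X V (deg s) (life s)) (ψ : S → G →ₗ[k] k)
    (hψ : ∀ s, ∀ v ∈ torsionBelow X V (deg s) (life s) ⊔ multiplesOf X V (deg s), ψ s v = 0)
    (hψ1 : ∀ s, ψ s (g s) = 1)
    (hψ0 : ∀ s s', s ≠ s' → deg s = deg s' → life s = life s' → ψ s (g s') = 0)
    (hspan : ∀ i j, torsionUpTo X V i j ≤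
      Submodule.span k {v | ∃ s, deg s = i ∧ life s = j ∧ g s = v} ⊔
        (torsionBelow X V i j ⊔ multiplesOf X V i))
    {M : Type*} [AddCommGroup M] [Module k M] [Module F M] [IsScalarTower k F M] {e : S → M}
    (he : Submodule.span F (Set.range e) = ⊤)
    (he0 : ∀ s, ∀ n : ℕ, life s ≤ n → X ^ n • e s = 0)
    (φ : M →ₗ[F] G) (hφ : ∀ s, φ (e s) = g s) : Function.Bijective φ := by
  let T : ℕ → Type _ := fun N => {s // deg s ≤ N ∧ (N : ℕ∞) < deg s + life s}
  let w : ∀ N, T N → G := fun N s => X ^ (N - deg s.1) • g s.1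
  have hli : ∀ N, LinearIndependent k (w N) := fun N =>
    linearIndependent_pow_smul hX hg ψ hψ hψ1 hψ0 N
  have hsp : ∀ N, Submodule.span k (Set.range (w N)) = V N := by
    refine fun N => le_antisymm (Submodule.span_le.2 ?_) ?_
    · rintro _ ⟨⟨s, hs, -⟩, rfl⟩
      have := pow_smul_mem hX (hg s).1 (N - deg s)
      rwa [Nat.add_sub_cancel' hs] at this
    · exact le_torsionUpTo_top.trans (torsionUpTo_le_span hg hspan N ⊤)
  let B := hV.collectedBasis fun N => (Module.Basis.span (hli N)).map (LinearEquiv.ofEq _ _ (hsp N))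
  let u : (Σ N, T N) → M := fun p => X ^ (p.1 - deg p.2.1) • e p.2.1
  have hu : ⇑(φ.restrictScalars k) ∘ u = B := by
    funext p
    rw [DirectSum.IsInternal.collectedBasis_coe]
    simp only [Module.Basis.map_apply, LinearEquiv.coe_ofEq_apply, Module.Basis.span_apply]
    simp [u, w, hφ]
  refine LinearMap.bijective_of_linearIndependent_of_span_eq_top (f := φ.restrictScalars k)
    (v := u) ?_ ?_ ?_
  · rw [eq_top_iff, ← Submodule.restrictScalars_top k F M, ← he,
      ← Submodule.span_smul_of_span_eq_top hF, Submodule.span_le]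
    rintro _ ⟨_, ⟨n, rfl⟩, _, ⟨s, rfl⟩, rfl⟩
    by_cases h : (n : ℕ∞) < life s
    · refine Submodule.subset_span ⟨⟨deg s + n, s, by omega, ?_⟩, ?_⟩
      · rw [Nat.cast_add]
        exact (ENat.add_lt_add_iff_left (ENat.natCast_ne_top _)).2 h
      · simp [u]
    · change X ^ n • e s ∈ _
      rw [he0 s n (not_lt.1 h)]
      exact zero_mem _
  · rw [hu]; exact B.linearIndependent
  · rw [hu]; exact B.span_eq

/-- In each degree and for each lifetime, generators are a basis of the elements of at most that
lifetime, modulo shorter-lived elements and multiples of X; lifetime ⊤ gives free summands. The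
behaviour of X in degree 0 and in degrees at least r confines the indices. -/
theorem exists_graded_decomposition (hV : DirectSum.IsInternal V)
    (hX : ∀ i, ∀ v ∈ V i, X • v ∈ V (i + 1))
    (hF : Submodule.span k (Set.range fun n : ℕ => X ^ n) = ⊤)
    [hfin : ∀ i, FiniteDimensional k (V i)] (r : ℕ)
    (hinj : ∀ i, r ≤ i → ∀ v ∈ V i, X • v = 0 → v = 0)
    (hsurj : ∀ i, r ≤ i → ∀ v ∈ V (i + 1), ∃ u ∈ V i, X • u = v)
    (h0 : ∀ n : ℕ, ∀ v ∈ V 0, X ^ n • v = 0 → v = 0) :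
    ∃ (α : ℕ → ℕ) (τ : ℕ → ℕ → ℕ) (φ : CyclicSum X (FreeIndex r α)
      (fun t : TorsionIndex r τ => t.1.1.2) ≃ₗ[F] G),
      (∀ t : FreeIndex r α, φ (CyclicSum.gen _ _ (Sum.inl t)) ∈ V t.1) ∧
      (∀ t : TorsionIndex r τ, φ (CyclicSum.gen _ _ (Sum.inr t)) ∈ V t.1.1.1) := by
  have hinj' : ∀ n i, r ≤ i → ∀ v ∈ V i, X ^ n • v = 0 → v = 0 := by
    intro n
    induction n with
    | zero => intro i _ v _ hv; simpa using hv
    | succ n ih =>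
      intro i hi v hv hv0
      rw [pow_succ, mul_smul] at hv0
      exact hinj i hi v hv (ih _ (by omega) _ (hX _ _ hv) hv0)
  have hfin' : ∀ i j, FiniteDimensional k (torsionUpTo X V i j) := fun i j =>
    Submodule.finiteDimensional_of_le (S₂ := V i) fun v hv => hv.1
  choose n b ψ hb hψ hψ1 hψ0 hspan hn using fun p : ℕ × ℕ∞ =>
    exists_dual_basis_modulo (torsionUpTo X V p.1 p.2)
      (torsionBelow X V p.1 p.2 ⊔ multiplesOf X V p.1)
  let α : ℕ → ℕ := fun i => n (i, ⊤)
  let τ : ℕ → ℕ → ℕ := fun i j => n (i, j)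
  let S := FreeIndex r α ⊕ TorsionIndex r τ
  let deg : S → ℕ := Sum.elim (fun t => t.1) fun t => t.1.1.1
  let life : S → ℕ∞ := Sum.elim (fun _ => ⊤) fun t => t.1.1.2
  let g : S → G := Sum.elim (fun t => b (t.1, ⊤) t.2) fun t => b (t.1.1.1, t.1.1.2) t.2
  let ψ' : S → G →ₗ[k] k := Sum.elim (fun t => ψ (t.1, ⊤) t.2) fun t => ψ (t.1.1.1, t.1.1.2) t.2
  have hg : ∀ s, g s ∈ torsionUpTo X V (deg s) (life s) := by
    rintro (t | t)
    · exact hb (t.1, ⊤) t.2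
    · exact hb (t.1.1.1, t.1.1.2) t.2
  have hspan' : ∀ i j, torsionUpTo X V i j ≤
      Submodule.span k {v | ∃ s, deg s = i ∧ life s = j ∧ g s = v} ⊔
        (torsionBelow X V i j ⊔ multiplesOf X V i) := by
    intro i j
    refine (hspan (i, j)).trans (sup_le_sup_right (Submodule.span_mono ?_) _)
    rintro _ ⟨l, rfl⟩
    have hl : n (i, j) ≠ 0 := fun h => (h ▸ l).elim0
    have hl' := mt (hn (i, j)) hl
    induction j using ENat.recTopCoe with
    | top =>
      have hi : i ≤ r := by
        by_contra! hi
        refine hl' (le_trans (fun v hv => ?_) le_sup_right)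
        obtain ⟨d, rfl⟩ := Nat.exists_eq_add_of_lt hi
        exact hsurj (r + d) (by omega) v hv.1
      exact ⟨Sum.inl ⟨⟨i, by omega⟩, l⟩, rfl, rfl, rfl⟩
    | coe j =>
      have hj : 1 ≤ j := by
        by_contra! hj
        refine hl' fun v hv => ?_
        have := hv.2 0 (by simp; omega)
        rw [pow_zero, one_smul] at this
        rw [this]; exact zero_mem _
      have hi : 1 ≤ i := by
        by_contra! hi
        obtain rfl : i = 0 := by omega
        refine hl' fun v hv => ?_
        rw [h0 j v hv.1 (hv.2 j le_rfl)]; exact zero_mem _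
      -- If i + j > r, then X^(r - i)v has degree at least r, where X is injective, so it is already
      -- zero and v lives shorter than j. For i > r the truncated r - i is 0 and v itself vanishes.
      have hij : i + j ≤ r := by
        by_contra! hij
        refine hl' fun v hv => Submodule.mem_sup_left ⟨hv.1, Or.inr ⟨r - i, ?_, ?_⟩⟩
        · rw [Nat.cast_lt]; omega
        · refine hinj' j (i + (r - i)) (by omega) _ (pow_smul_mem hX hv.1 _) ?_
          rw [smul_comm, hv.2 j le_rfl, smul_zero]
      exact ⟨Sum.inr ⟨⟨(i, j), hi, hj, hij⟩, l⟩, rfl, rfl, rfl⟩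
  obtain ⟨φ, hφ⟩ := CyclicSum.exists_lift (X := X) (I := FreeIndex r α)
    (ℓ := fun t : TorsionIndex r τ => t.1.1.2) g fun t => (hg (Sum.inr t)).2 _ le_rfl
  have hbij : Function.Bijective φ := by
    refine bijective_of_generators hV hX hF hg ψ' ?_ ?_ ?_ hspan'
      (CyclicSum.span_gen X fun t : TorsionIndex r τ => t.1.1.2) ?_ φ hφ
    · rintro (t | t)
      · exact hψ (t.1, ⊤) t.2
      · exact hψ (t.1.1.1, t.1.1.2) t.2
    · rintro (t | t)
      · exact hψ1 (t.1, ⊤) t.2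
      · exact hψ1 (t.1.1.1, t.1.1.2) t.2
    · rintro (⟨⟨i, hi⟩, l⟩ | ⟨⟨⟨i, j⟩, hi⟩, l⟩) (⟨⟨i', hi'⟩, l'⟩ | ⟨⟨⟨i', j'⟩, hi'⟩, l'⟩) hne h1 h2
      · obtain rfl : i = i' := h1
        exact hψ0 (i, ⊤) l l' (by rintro rfl; exact hne rfl)
      · exact absurd h2 (ENat.top_ne_natCast _)
      · exact absurd h2 (ENat.natCast_ne_top _)
      · obtain rfl : i = i' := h1
        obtain rfl : j = j' := Nat.cast_injective h2
        exact hψ0 (i, j) l l' (by rintro rfl; exact hne rfl)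
    · rintro (t | t) n hn
      · simp [life] at hn
      · exact CyclicSum.pow_smul_gen_inr X _ (by simpa [life] using hn)
  refine ⟨α, τ, LinearEquiv.ofBijective φ hbij, fun t => ?_, fun t => ?_⟩
  · have := (hg (Sum.inl t)).1
    rw [← hφ] at this
    exact this
  · have := (hg (Sum.inr t)).1
    rw [← hφ] at this
    exact this

/-- If `V N` is spanned modulo `X V (N - 1)` by one element, which is not a multiple of `X`, then
homogeneous generators that are independent modulo `X` include exactly one of degree `N`. -/
theorem existsUnique_generator (hV : DirectSum.IsInternal V)
    (hX : ∀ i, ∀ v ∈ V i, X • v ∈ V (i + 1))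
    (hF : Submodule.span k (Set.range fun n : ℕ => X ^ n) = ⊤)
    {S : Type*} {deg : S → ℕ} {g : S → G} (hg : ∀ s, g s ∈ V (deg s))
    (hspan : Submodule.span F (Set.range g) = ⊤) (p : S → G →ₗ[F] F ⧸ Ideal.span {X})
    (hp1 : ∀ s, p s (g s) = 1) (hp0 : ∀ s s', s ≠ s' → p s (g s') = 0)
    (hne : Ideal.span {X} ≠ ⊤) {N : ℕ} {w : G} (hw : w ∈ V N)
    (hw' : w ∉ multiplesOf X V N)
    (hVN : V N ≤ Submodule.span k {w} ⊔ multiplesOf X V N) :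
    ∃! s, deg s = N := by
  have hmul : ∀ v ∈ multiplesOf X V N, ∃ u, X • u = v := by
    intro v hv
    cases N with
    | zero => exact ⟨0, by rw [(Submodule.mem_bot k).1 hv, smul_zero]⟩
    | succ N => exact ⟨_, (mem_multiplesOf_succ.1 hv).choose_spec.2⟩
  have hpm : ∀ s, ∀ v ∈ multiplesOf X V N, p s v = 0 := by
    intro s v hv
    obtain ⟨u, rfl⟩ := hmul v hv
    obtain ⟨f, hf⟩ := Ideal.Quotient.mk_surjective (p s u)
    rw [map_smul, ← hf, Algebra.smul_def, Ideal.Quotient.algebraMap_eq, ← map_mul,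
      Ideal.Quotient.eq_zero_iff_mem]
    exact Ideal.mul_mem_right _ _ (Ideal.mem_span_singleton_self X)
  have : Nontrivial (F ⧸ Ideal.span {X}) := Ideal.Quotient.nontrivial_iff.2 hne
  have hV' : Function.Bijective (DirectSum.coeLinearMap V) := hV
  let proj : G →ₗ[k] G := (V N).subtype ∘ₗ DirectSum.component k ℕ (fun i => V i) N ∘ₗ
    (LinearEquiv.ofBijective (DirectSum.coeLinearMap V) hV').symm.toLinearMap
  have hproj : ∀ i, ∀ v ∈ V i, proj v = if i = N then v else 0 := by
    intro i v hv
    have : (LinearEquiv.ofBijective (DirectSum.coeLinearMap V) hV').symm v =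
        DirectSum.lof k ℕ (fun i => V i) i ⟨v, hv⟩ := by
      rw [LinearEquiv.symm_apply_eq, LinearEquiv.ofBijective_apply, DirectSum.coeLinearMap_lof]
    simp only [proj, LinearMap.comp_apply, LinearEquiv.coe_coe, this]
    split_ifs with h
    · subst h; rw [DirectSum.component.lof_self]; rfl
    · rw [DirectSum.component.of, dif_neg h, map_zero]
  obtain ⟨s, hs⟩ : ∃ s, deg s = N := by
    by_contra! hcon
    -- Without a generator of degree N, any Xⁿ·g s landing in degree N has n ≥ 1, so all of V N,
    -- including `w`, would consist of multiples of X.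
    have hle : (⊤ : Submodule k G) ≤ (multiplesOf X V N).comap proj := by
      rw [← Submodule.restrictScalars_top k F G, ← hspan,
        ← Submodule.span_smul_of_span_eq_top hF, Submodule.span_le]
      rintro _ ⟨_, ⟨n, rfl⟩, _, ⟨s, rfl⟩, rfl⟩
      change proj (X ^ n • g s) ∈ multiplesOf X V N
      rw [hproj _ _ (pow_smul_mem hX (hg s) n)]
      split_ifs with h
      · obtain ⟨m, rfl⟩ : ∃ m, n = m + 1 := ⟨n - 1, by have := hcon s; omega⟩
        rw [← h, ← add_assoc, mem_multiplesOf_succ]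
        exact ⟨_, pow_smul_mem hX (hg s) m, by rw [smul_smul, ← pow_succ']⟩
      · exact zero_mem _
    have := hle (Submodule.mem_top (x := w))
    rw [Submodule.mem_comap, hproj N w hw, if_pos rfl] at this
    exact hw' this
  refine ⟨s, hs, fun s' hs' => ?_⟩
  -- Modulo X, two generators of degree N would both be scalar multiples of `w`, contradicting their
  -- independence.
  have hdec : ∀ s, deg s = N → ∃ c : k, ∀ s', p s' (g s) = algebraMap k F c • p s' w := by
    intro s hs
    obtain ⟨_, hc, m, hm, h⟩ := Submodule.mem_sup.1 (hVN (hs ▸ hg s))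
    obtain ⟨c, rfl⟩ := Submodule.mem_span_singleton.1 hc
    refine ⟨c, fun s' => ?_⟩
    rw [← h, map_add, hpm s' m hm, add_zero, ← map_smul, algebraMap_smul]
  by_contra hne'
  obtain ⟨c, hc⟩ := hdec s hs
  obtain ⟨c', hc'⟩ := hdec s' hs'
  have hc0 : c ≠ 0 := by
    rintro rfl
    have := hc s
    rw [hp1, map_zero, zero_smul] at this
    exact one_ne_zero this
  have h1 : p s' w = 0 := by
    have h2 := congrArg (algebraMap k F c⁻¹ • ·) (hc s')
    simp only [hp0 s' s hne', smul_zero, smul_smul, ← map_mul, inv_mul_cancel₀ hc0, map_one,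
      one_smul] at h2
    exact h2.symm
  have h2 := hc' s'
  rw [hp1, h1, smul_zero] at h2
  exact one_ne_zero h2

end Decomposition

/-! ### Fiber cones as graded algebras over the residue field. -/

namespace FiberCone

variable {A : Type*} [CommRing A] [IsLocalRing A] {I : Ideal A}

theorem mk_eq_zero_iff (f : reesAlgebra I) :
    FiberCone.mk I f = 0 ↔ ∀ n, (f : A[X]).coeff n ∈ maximalIdeal A * I ^ n := by
  rw [FiberCone.mk]
  refine Ideal.Quotient.eq_zero_iff_mem.trans ⟨fun hf n => ?_, fun hf => ?_⟩
  · induction hf using Submodule.span_induction generalizing n with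
    | mem f hf =>
      obtain ⟨a, ha, rfl⟩ := hf
      change (C a : A[X]).coeff n ∈ _
      rw [coeff_C]
      split_ifs with h
      · subst h; simpa using ha
      · exact zero_mem _
    | zero => exact zero_mem _
    | add f g _ _ hf hg => exact add_mem (hf n) (hg n)
    | smul f g _ hg =>
      change ((f : A[X]) * g).coeff n ∈ _
      rw [coeff_mul]
      refine Ideal.sum_mem _ fun p hp => ?_
      rw [← Finset.HasAntidiagonal.mem_antidiagonal.1 hp, pow_add, mul_left_comm]
      exact Ideal.mul_mem_mul (f.2 p.1) (hg p.2)
  · have hmon : ∀ n, ∀ a ∈ maximalIdeal A * I ^ n, ∀ ha : a ∈ I ^ n,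
        (⟨monomial n a, reesAlgebra.monomial_mem.2 ha⟩ : reesAlgebra I) ∈
          (maximalIdeal A).map (algebraMap A (reesAlgebra I)) := by
      intro n a ha
      induction ha using Submodule.mul_induction_on' with
      | mem_mul_mem c hc d hd =>
        intro ha
        have : (⟨monomial n (c * d), reesAlgebra.monomial_mem.2 ha⟩ : reesAlgebra I) =
            ⟨monomial n d, reesAlgebra.monomial_mem.2 hd⟩ * algebraMap A (reesAlgebra I) c := by
          refine Subtype.ext ?_
          change monomial n (c * d) = monomial n d * C c
          rw [monomial_mul_C, mul_comm]
        rw [this]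
        exact Ideal.mul_mem_left _ _ (Ideal.mem_map_of_mem _ hc)
      | add a ha' b hb' iha ihb =>
        intro _
        have := add_mem (iha (Ideal.mul_le_right ha')) (ihb (Ideal.mul_le_right hb'))
        convert this using 1
        refine Subtype.ext ?_
        simp
    have : f = ∑ n ∈ (f : A[X]).support,
        (⟨monomial n ((f : A[X]).coeff n), reesAlgebra.monomial_mem.2 (f.2 n)⟩ :
          reesAlgebra I) := by
      refine Subtype.ext ?_
      rw [AddSubmonoidClass.coe_finsetSum]
      exact (f : A[X]).as_sum_support
    rw [this]
    exact Ideal.sum_mem _ fun n _ => hmon n _ (hf n) (f.2 n)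

theorem of_eq_zero_iff {n : ℕ} {a : A} (ha : a ∈ I ^ n) :
    FiberCone.of I n a ha = 0 ↔ a ∈ maximalIdeal A * I ^ n := by
  rw [FiberCone.of, mk_eq_zero_iff]
  refine ⟨fun h => by simpa using h n, fun h m => ?_⟩
  change (monomial n a).coeff m ∈ _
  rw [coeff_monomial]
  split_ifs with hnm
  · exact hnm ▸ h
  · exact zero_mem _

theorem of_add {n : ℕ} {a b : A} (ha : a ∈ I ^ n) (hb : b ∈ I ^ n) :
    FiberCone.of I n (a + b) (add_mem ha hb) = FiberCone.of I n a ha + FiberCone.of I n b hb := by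
  rw [FiberCone.of, FiberCone.of, FiberCone.of, ← map_add]
  congr 1
  exact Subtype.ext (map_add _ a b)

theorem of_congr {n m : ℕ} {a b : A} (hn : n = m) (h : a = b) (ha : a ∈ I ^ n) (hb : b ∈ I ^ m) :
    FiberCone.of I n a ha = FiberCone.of I m b hb := by
  subst hn h; rfl

theorem of_mul_of {n m : ℕ} {a b : A} (ha : a ∈ I ^ n) (hb : b ∈ I ^ m) :
    FiberCone.of I n a ha * FiberCone.of I m b hb =
      FiberCone.of I (n + m) (a * b) (pow_add I n m ▸ Ideal.mul_mem_mul ha hb) := by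
  rw [FiberCone.of, FiberCone.of, FiberCone.of, ← map_mul]
  congr 1
  exact Subtype.ext (monomial_mul_monomial n m a b)

theorem mk_eq_sum (f : reesAlgebra I) : FiberCone.mk I f =
    ∑ n ∈ (f : A[X]).support, FiberCone.of I n ((f : A[X]).coeff n) (f.2 n) := by
  simp only [FiberCone.of]
  rw [← map_sum]
  congr 1
  refine Subtype.ext ?_
  rw [AddSubmonoidClass.coe_finsetSum]
  exact (f : A[X]).as_sum_support

theorem mk_surjective : Function.Surjective (FiberCone.mk I) := Ideal.Quotient.mk_surjective

/-- The residue field acts on the fiber cone. -/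
noncomputable instance residueFieldAlgebra : Algebra (ResidueField A) (FiberCone I) :=
  (Ideal.Quotient.lift (maximalIdeal A)
    ((FiberCone.mk I).comp (algebraMap A (reesAlgebra I))) fun _ ha =>
      Ideal.Quotient.eq_zero_iff_mem.2 (Ideal.mem_map_of_mem _ ha)).toAlgebra

theorem algebraMap_residue (c : A) :
    algebraMap (ResidueField A) (FiberCone I) (residue A c) = FiberCone.of I 0 c (by simp) := rfl

theorem residue_smul_of (c : A) {n : ℕ} {a : A} (ha : a ∈ I ^ n) :
    residue A c • FiberCone.of I n a ha = FiberCone.of I n (c * a) (Ideal.mul_mem_left _ c ha) := by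
  rw [Algebra.smul_def, algebraMap_residue, of_mul_of]
  exact of_congr (zero_add n) rfl _ _

instance : RingHomSurjective (residue A) := ⟨residue_surjective⟩

/-- The map `I ^ n → I ^ n / 𝔪 I ^ n`. -/
noncomputable def ofₛₗ (I : Ideal A) (n : ℕ) : ↥(I ^ n) →ₛₗ[residue A] FiberCone I where
  toFun a := FiberCone.of I n a a.2
  map_add' a b := of_add a.2 b.2
  map_smul' c a := (residue_smul_of c a.2).symm

/-- The homogeneous elements of degree `n`, as a subspace. -/
noncomputable def gradedPiece (I : Ideal A) (n : ℕ) : Submodule (ResidueField A) (FiberCone I) :=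
  LinearMap.range (ofₛₗ I n)

theorem mem_gradedPiece {n : ℕ} {v : FiberCone I} :
    v ∈ gradedPiece I n ↔ ∃ (a : A) (ha : a ∈ I ^ n), FiberCone.of I n a ha = v :=
  ⟨fun ⟨a, h⟩ => ⟨a.1, a.2, h⟩, fun ⟨a, ha, h⟩ => ⟨⟨a, ha⟩, h⟩⟩

theorem mem_component_iff {n : ℕ} {v : FiberCone I} :
    v ∈ FiberCone.component I n ↔ v ∈ gradedPiece I n :=
  ⟨fun ⟨a, ha, h⟩ => ⟨⟨a, ha⟩, h.symm⟩, fun ⟨a, h⟩ => ⟨a.1, a.2, h.symm⟩⟩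

instance [IsNoetherianRing A] (n : ℕ) : FiniteDimensional (ResidueField A) (gradedPiece I n) := by
  rw [FiniteDimensional, Module.finite_def, Submodule.fg_top, gradedPiece, LinearMap.range_eq_map]
  exact Submodule.FG.map _ (Module.Finite.fg_top (R := A) (M := ↥(I ^ n)))

theorem mul_mem_gradedPiece {n m : ℕ} {v w : FiberCone I} (hv : v ∈ gradedPiece I n)
    (hw : w ∈ gradedPiece I m) : v * w ∈ gradedPiece I (n + m) := by
  obtain ⟨a, ha, rfl⟩ := mem_gradedPiece.1 hv
  obtain ⟨b, hb, rfl⟩ := mem_gradedPiece.1 hw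
  exact mem_gradedPiece.2 ⟨_, _, (of_mul_of ha hb).symm⟩

variable (I) in
theorem isInternal_gradedPiece : DirectSum.IsInternal (gradedPiece I) := by
  classical
  constructor
  · rw [injective_iff_map_eq_zero]
    intro v hv
    rw [DirectSum.coeAddMonoidHom_eq_dfinsuppSum, DFinsupp.sum] at hv
    have h := fun n => mem_gradedPiece.1 (v n).2
    choose a ha hav using h
    simp only [← hav, FiberCone.of] at hv
    rw [← map_sum, mk_eq_zero_iff] at hv
    refine DFinsupp.ext fun n => Subtype.ext ?_
    change (v n : FiberCone I) = 0
    by_contra hn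
    rw [← hav n, of_eq_zero_iff] at hn
    refine hn ?_
    have h1 := hv n
    rw [AddSubmonoidClass.coe_finsetSum, finsetSum_coeff,
      Finset.sum_eq_single n (fun m _ hm => by simp [coeff_monomial, hm]) (fun hm => ?_)] at h1
    · simpa using h1
    · exfalso
      refine hn ?_
      have : v n = 0 := by simpa using hm
      rw [← of_eq_zero_iff (ha n), hav, this]; rfl
  · intro z
    obtain ⟨f, rfl⟩ := mk_surjective z
    rw [mk_eq_sum]
    refine ⟨∑ n ∈ (f : A[X]).support, DirectSum.of (fun n => gradedPiece I n) n
      ⟨_, mem_gradedPiece.2 ⟨_, f.2 n, rfl⟩⟩, ?_⟩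
    rw [map_sum]
    exact Finset.sum_congr rfl fun n _ => DirectSum.coeAddMonoidHom_of _ _ _

theorem map_of {J : Ideal A} (h : I ≤ J) {n : ℕ} {a : A} (ha : a ∈ I ^ n) :
    FiberCone.map h (FiberCone.of I n a ha) = FiberCone.of J n a (Ideal.pow_right_mono h n ha) := rfl

theorem map_algebraMap {J : Ideal A} (h : I ≤ J) (c : ResidueField A) :
    FiberCone.map h (algebraMap _ _ c) = algebraMap _ _ c := by
  obtain ⟨c, rfl⟩ := residue_surjective c
  rfl

end FiberCone

/-! ### F(x) is spanned by the powers of x*. -/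

section NoetherNormalization

variable {A : Type*} [CommRing A] [IsLocalRing A] {x : A}

theorem initialForm_pow (n : ℕ) : initialForm x ^ n =
    FiberCone.of (Ideal.span {x}) n (x ^ n)
      (Ideal.pow_mem_pow (Ideal.mem_span_singleton_self x) n) := by
  induction n with
  | zero =>
    rw [pow_zero]
    exact FiberCone.of_congr rfl (pow_zero x).symm (by simp) _
  | succ n ih =>
    rw [pow_succ, ih, initialForm, FiberCone.of_mul_of]
    exact FiberCone.of_congr rfl (pow_succ x n).symm _ _

theorem exists_eq_smul_initialForm_pow {n : ℕ} {f : NoetherNormalization x}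
    (hf : f ∈ FiberCone.gradedPiece (Ideal.span {x}) n) :
    ∃ c : ResidueField A, f = c • initialForm x ^ n := by
  obtain ⟨a, ha, rfl⟩ := FiberCone.mem_gradedPiece.1 hf
  have ha' := ha
  rw [Ideal.span_singleton_pow] at ha'
  obtain ⟨c, rfl⟩ := Ideal.mem_span_singleton'.1 ha'
  exact ⟨residue A c, by rw [initialForm_pow, FiberCone.residue_smul_of]⟩

theorem span_initialForm_pow :
    Submodule.span (ResidueField A) (Set.range fun n : ℕ => initialForm x ^ n) = ⊤ := by
  rw [eq_top_iff]
  rintro f -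
  obtain ⟨f, rfl⟩ := FiberCone.mk_surjective f
  rw [FiberCone.mk_eq_sum]
  refine Submodule.sum_mem _ fun n _ => ?_
  obtain ⟨c, hc⟩ := exists_eq_smul_initialForm_pow (x := x)
    (FiberCone.mem_gradedPiece.2 ⟨_, f.2 n, rfl⟩)
  rw [hc]
  exact Submodule.smul_mem _ _ (Submodule.subset_span ⟨n, rfl⟩)

theorem span_initialForm_ne_top : Ideal.span {initialForm x} ≠ ⊤ := by
  rw [Ne, Ideal.eq_top_iff_one, Ideal.mem_span_singleton']
  rintro ⟨f, hf⟩
  obtain ⟨f, rfl⟩ := FiberCone.mk_surjective f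
  rw [initialForm, FiberCone.of, ← map_one (FiberCone.mk _), ← map_mul, ← sub_eq_zero, ← map_sub,
    FiberCone.mk_eq_zero_iff] at hf
  have := hf 0
  change ((f : A[X]) * monomial 1 x - 1).coeff 0 ∈ _ at this
  simp [mul_coeff_zero] at this

end NoetherNormalization

/-! ### The tangent cone as a graded F(x)-module. -/

section TangentCone

theorem eq_one_of_existsUnique_index {r N : ℕ} {α : ℕ → ℕ} {τ : ℕ → ℕ → ℕ}
    (h : ∃! s : FreeIndex r α ⊕ TorsionIndex r τ,
      Sum.elim (fun t => (t.1 : ℕ)) (fun t => t.1.1.1) s = N)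
    (hτ : ∀ t : TorsionIndex r τ, t.1.1.1 ≠ N) : α N = 1 := by
  obtain ⟨⟨⟨i, hi⟩, l⟩ | t, hs, hu⟩ := h
  · obtain rfl : i = N := hs
    rw [← Fintype.card_fin (α i), Fintype.card_eq_one_iff]
    refine ⟨l, fun l' => ?_⟩
    have := hu (Sum.inl ⟨⟨i, hi⟩, l'⟩) rfl
    simpa using this
  · exact absurd hs (hτ t)

variable {A : Type*} [CommRing A] [IsLocalRing A]

theorem map_initialForm_mul_of {x : A} (hx : Ideal.span {x} ≤ maximalIdeal A) {n : ℕ} {a : A}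
    (ha : a ∈ maximalIdeal A ^ n) (hxa : x * a ∈ maximalIdeal A ^ (n + 1)) :
    FiberCone.map hx (initialForm x) * FiberCone.of _ n a ha =
      FiberCone.of _ (n + 1) (x * a) hxa := by
  rw [initialForm, FiberCone.map_of, FiberCone.of_mul_of]
  exact FiberCone.of_congr (add_comm 1 n) rfl _ _

/-- By linearity, gradedness need only be checked on the generators of the summands. -/
theorem areTangentConeInvariants_iff {x : A} (hx : Ideal.span {x} ≤ maximalIdeal A) {r : ℕ}
    {α : ℕ → ℕ} {τ : ℕ → ℕ → ℕ} :
    letI : Module (NoetherNormalization x) (TangentCone A) :=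
      Module.compHom (TangentCone A) (FiberCone.map hx)
    AreTangentConeInvariants x hx r α τ ↔
      ∃ φ : CyclicSum (initialForm x) (FreeIndex r α) (fun t : TorsionIndex r τ => t.1.1.2)
          ≃ₗ[NoetherNormalization x] TangentCone A,
        (∀ t : FreeIndex r α, φ (CyclicSum.gen _ _ (Sum.inl t)) ∈
          FiberCone.gradedPiece (maximalIdeal A) t.1) ∧
        (∀ t : TorsionIndex r τ, φ (CyclicSum.gen _ _ (Sum.inr t)) ∈
          FiberCone.gradedPiece (maximalIdeal A) t.1.1.1) := by
  let : Module (NoetherNormalization x) (TangentCone A) :=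
    Module.compHom (TangentCone A) (FiberCone.map hx)
  have h1 : (1 : NoetherNormalization x) ∈ FiberCone.component (Ideal.span {x}) 0 :=
    ⟨1, by simp, rfl⟩
  constructor
  · rintro ⟨φ, hφ, hfree, htor⟩
    refine ⟨{ φ with map_smul' := hφ }, fun t => ?_, fun t => ?_⟩
    · have := hfree t 0 1 h1
      rw [zero_add] at this
      exact FiberCone.mem_component_iff.1 this
    · have := htor t 0 1 h1
      rw [zero_add] at this
      exact FiberCone.mem_component_iff.1 this
  · rintro ⟨φ, hfree, htor⟩
    have hmul : ∀ (d i : ℕ), ∀ f ∈ FiberCone.component (Ideal.span {x}) d,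
        ∀ v ∈ FiberCone.gradedPiece (maximalIdeal A) i,
          f • v ∈ FiberCone.component (maximalIdeal A) (d + i) := by
      rintro d i _ ⟨a, ha, rfl⟩ v hv
      exact FiberCone.mem_component_iff.2 (FiberCone.mul_mem_gradedPiece
        (FiberCone.mem_gradedPiece.2 ⟨a, Ideal.pow_right_mono hx d ha, rfl⟩) hv)
    refine ⟨φ.toAddEquiv, fun f v => map_smul φ f v, fun t d f hf => ?_, fun t d f hf => ?_⟩
    · have := hmul d _ f hf _ (hfree t)
      rwa [← map_smul, CyclicSum.smul_gen_inl] at this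
    · have := hmul d _ f hf _ (htor t)
      rwa [← map_smul, CyclicSum.smul_gen_inr] at this

theorem initialForm_mul_mem {x : A} (hx : Ideal.span {x} ≤ maximalIdeal A) (i : ℕ)
    (v : TangentCone A) (hv : v ∈ FiberCone.gradedPiece (maximalIdeal A) i) :
    FiberCone.map hx (initialForm x) * v ∈ FiberCone.gradedPiece (maximalIdeal A) (i + 1) := by
  obtain ⟨a, ha, rfl⟩ := FiberCone.mem_gradedPiece.1 hv
  have hxa : x * a ∈ maximalIdeal A ^ (i + 1) := by
    rw [pow_succ']
    exact Ideal.mul_mem_mul (hx (Ideal.mem_span_singleton_self x)) ha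
  rw [map_initialForm_mul_of hx ha hxa]
  exact FiberCone.mem_gradedPiece.2 ⟨_, _, rfl⟩

/-- If xa ∈ 𝔪ⁱ⁺² = x𝔪ⁱ⁺¹, cancelling `x` gives a ∈ 𝔪ⁱ⁺¹. The equality is needed only at exponent i +
1, so injectivity starts in degree r - 1, one before surjectivity. -/
theorem eq_zero_of_initialForm_mul_eq_zero {x : A} (hreg : x ∈ A⁰)
    (hx : Ideal.span {x} ≤ maximalIdeal A) {i : ℕ}
    (hi : maximalIdeal A ^ (i + 1 + 1) = Ideal.span {x} * maximalIdeal A ^ (i + 1))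
    {v : TangentCone A} (hv : v ∈ FiberCone.gradedPiece (maximalIdeal A) i)
    (h : FiberCone.map hx (initialForm x) * v = 0) : v = 0 := by
  obtain ⟨a, ha, rfl⟩ := FiberCone.mem_gradedPiece.1 hv
  have hxa : x * a ∈ maximalIdeal A ^ (i + 1) := by
    rw [pow_succ']
    exact Ideal.mul_mem_mul (hx (Ideal.mem_span_singleton_self x)) ha
  rw [map_initialForm_mul_of hx ha hxa, FiberCone.of_eq_zero_iff, ← pow_succ', hi] at h
  rw [FiberCone.of_eq_zero_iff, ← pow_succ']
  obtain ⟨b, hb, hab⟩ := Ideal.mem_span_singleton_mul.1 h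
  rwa [← (mul_cancel_left_mem_nonZeroDivisors hreg).1 hab]

theorem isScalarTower_tangentCone {x : A} (hx : Ideal.span {x} ≤ maximalIdeal A) :
    letI : Module (NoetherNormalization x) (TangentCone A) :=
      Module.compHom (TangentCone A) (FiberCone.map hx)
    IsScalarTower (ResidueField A) (NoetherNormalization x) (TangentCone A) := by
  let : Module (NoetherNormalization x) (TangentCone A) :=
    Module.compHom (TangentCone A) (FiberCone.map hx)
  refine ⟨fun c f v => ?_⟩
  change FiberCone.map hx (c • f) * v = c • (FiberCone.map hx f * v)
  rw [Algebra.smul_def, map_mul, FiberCone.map_algebraMap, mul_assoc, ← Algebra.smul_def]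

theorem exists_areTangentConeInvariants [IsNoetherianRing A] {x : A} (hreg : x ∈ A⁰)
    (hx : IsReduction (Ideal.span {x}) (maximalIdeal A)) {r : ℕ}
    (hr : ∀ n, r ≤ n → maximalIdeal A ^ (n + 1) = Ideal.span {x} * maximalIdeal A ^ n) :
    ∃ α τ, AreTangentConeInvariants x hx.1 r α τ := by
  let : Module (NoetherNormalization x) (TangentCone A) :=
    Module.compHom (TangentCone A) (FiberCone.map hx.1)
  have := isScalarTower_tangentCone hx.1
  obtain ⟨α, τ, h⟩ := exists_graded_decomposition (k := ResidueField A)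
    (FiberCone.isInternal_gradedPiece (maximalIdeal A)) (X := initialForm x)
    (initialForm_mul_mem hx.1) span_initialForm_pow r
    (fun i hi v hv h => eq_zero_of_initialForm_mul_eq_zero hreg hx.1 (hr _ (by omega)) hv h)
    (fun i hi v hv => by
      obtain ⟨a, ha, rfl⟩ := FiberCone.mem_gradedPiece.1 hv
      have ha' := ha
      rw [hr i hi] at ha'
      obtain ⟨b, hb, rfl⟩ := Ideal.mem_span_singleton_mul.1 ha'
      exact ⟨_, FiberCone.mem_gradedPiece.2 ⟨b, hb, rfl⟩, map_initialForm_mul_of hx.1 hb ha⟩)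
    (fun n v hv h => by
      obtain ⟨c, hc, rfl⟩ := FiberCone.mem_gradedPiece.1 hv
      change FiberCone.map hx.1 (initialForm x ^ n) * _ = 0 at h
      rw [initialForm_pow, FiberCone.map_of, FiberCone.of_mul_of, FiberCone.of_eq_zero_iff,
        ← pow_succ', add_zero] at h
      rw [FiberCone.of_eq_zero_iff, pow_zero, mul_one]
      -- A nonzero class of degree 0 is a unit c, and cxⁿ ∈ 𝔪ⁿ⁺¹ is excluded by
      -- `IsReduction.pow_notMem_pow`.
      by_contra hu
      obtain ⟨c, rfl⟩ : IsUnit c := by simpa using hu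
      refine hx.pow_notMem_pow hreg n ?_
      simpa using Ideal.mul_mem_right (↑c⁻¹ : A) _ h)
  exact ⟨α, τ, (areTangentConeInvariants_iff hx.1).2 h⟩

theorem tangentConeInvariants_eq_one [IsNoetherianRing A] {x : A} (hreg : x ∈ A⁰)
    (hx : IsReduction (Ideal.span {x}) (maximalIdeal A)) {r : ℕ}
    (hr : ∀ n, maximalIdeal A ^ (n + 1) = Ideal.span {x} * maximalIdeal A ^ n ↔ r ≤ n)
    (hr3 : 3 ≤ r) (h : HasAlmostMinimalMultiplicity A) {α : ℕ → ℕ} {τ : ℕ → ℕ → ℕ}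
    (hατ : AreTangentConeInvariants x hx.1 r α τ) : α r = 1 ∧ α (r - 1) = 1 := by
  let : Module (NoetherNormalization x) (TangentCone A) :=
    Module.compHom (TangentCone A) (FiberCone.map hx.1)
  have := isScalarTower_tangentCone hx.1
  obtain ⟨φ, hfree, htor⟩ := (areTangentConeInvariants_iff hx.1).1 hατ
  obtain ⟨y, hy, z, hz, hyz⟩ := h.exists_generator hreg hx
  choose p hp1 hp0 using CyclicSum.exists_coord (X := initialForm x) (I := FreeIndex r α)
    (ℓ := fun t : TorsionIndex r τ => t.1.1.2) fun t => t.1.2.2.1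
  have key : ∀ M, 1 ≤ M → M < r → ∃! s : FreeIndex r α ⊕ TorsionIndex r τ,
      Sum.elim (fun t => (t.1 : ℕ)) (fun t => t.1.1.1) s = M + 1 := by
    intro M hM hMr
    obtain ⟨hgen, -⟩ := hyz M hM
    have hwmem : y ^ M * z ∈ maximalIdeal A ^ (M + 1) := by
      rw [pow_succ]; exact Ideal.mul_mem_mul (Ideal.pow_mem_pow hy M) hz
    refine existsUnique_generator (k := ResidueField A) (X := initialForm x)
      (FiberCone.isInternal_gradedPiece (maximalIdeal A)) (initialForm_mul_mem hx.1)
      span_initialForm_pow (g := fun s => φ (CyclicSum.gen _ _ s)) ?_ ?_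
      (fun s => p s ∘ₗ φ.symm.toLinearMap) ?_ ?_ span_initialForm_ne_top
      (FiberCone.mem_gradedPiece.2 ⟨y ^ M * z, hwmem, rfl⟩) ?_ ?_
    · rintro (t | t)
      · exact hfree t
      · exact htor t
    · rw [Set.range_comp' φ (CyclicSum.gen (initialForm x) _), ← LinearEquiv.coe_coe,
        ← Submodule.map_span, CyclicSum.span_gen, Submodule.map_top, LinearEquiv.range]
    · intro s; simpa using hp1 s
    · intro s s' hs; simpa using hp0 s s' hs
    · rw [mem_multiplesOf_succ]
      rintro ⟨v, hv, hvw⟩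
      obtain ⟨b, hb, rfl⟩ := FiberCone.mem_gradedPiece.1 hv
      have hxb : x * b ∈ maximalIdeal A ^ (M + 1) := by
        rw [pow_succ']
        exact Ideal.mul_mem_mul (hx.1 (Ideal.mem_span_singleton_self x)) hb
      change FiberCone.map hx.1 (initialForm x) * _ = _ at hvw
      rw [map_initialForm_mul_of hx.1 hb hxb] at hvw
      have hsub : FiberCone.of (maximalIdeal A) (M + 1) (y ^ M * z - x * b)
          (sub_mem hwmem hxb) = 0 := by
        rw [← add_left_inj (FiberCone.of (maximalIdeal A) (M + 1) (x * b) hxb),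
          ← FiberCone.of_add, zero_add, hvw]
        exact FiberCone.of_congr rfl (sub_add_cancel _ _) _ _
      rw [FiberCone.of_eq_zero_iff] at hsub
      -- If the class of yᴹz were a multiple of x*, Nakayama would give 𝔪ᴹ⁺¹ = x𝔪ᴹ, impossible for M
      -- < r.
      have hle : maximalIdeal A ^ (M + 1) ≤ Ideal.span {x} * maximalIdeal A ^ M ⊔
          maximalIdeal A • maximalIdeal A ^ (M + 1) := by
        nth_rewrite 1 [hgen]
        refine sup_le le_sup_left ((Ideal.span_singleton_le_iff_mem _).2 ?_)
        rw [← add_sub_cancel (x * b) (y ^ M * z)]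
        exact add_mem (Ideal.mem_sup_left (Ideal.mul_mem_mul (Ideal.mem_span_singleton_self x) hb))
          (Ideal.mem_sup_right hsub)
      have hle' := Submodule.le_of_le_smul_of_le_jacobson_bot
        (IsNoetherian.noetherian (maximalIdeal A ^ (M + 1))) (maximalIdeal_le_jacobson _) hle
      have hge : Ideal.span {x} * maximalIdeal A ^ M ≤ maximalIdeal A ^ (M + 1) := by
        rw [pow_succ']; exact Ideal.mul_mono_left hx.1
      exact absurd ((hr M).1 (le_antisymm hle' hge)) (by omega)
    · intro v hv
      obtain ⟨a, ha, rfl⟩ := FiberCone.mem_gradedPiece.1 hv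
      have ha' := ha
      rw [hgen] at ha'
      obtain ⟨_, hu, _, hw, rfl⟩ := Submodule.mem_sup.1 ha'
      obtain ⟨b, hb, rfl⟩ := Ideal.mem_span_singleton_mul.1 hu
      obtain ⟨c, rfl⟩ := Ideal.mem_span_singleton'.1 hw
      have hxb : x * b ∈ maximalIdeal A ^ (M + 1) := by
        rw [pow_succ']
        exact Ideal.mul_mem_mul (hx.1 (Ideal.mem_span_singleton_self x)) hb
      rw [FiberCone.of_add hxb (Ideal.mul_mem_left _ c hwmem), ← FiberCone.residue_smul_of c hwmem]
      refine add_mem (Submodule.mem_sup_right ?_) (Submodule.mem_sup_left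
        (Submodule.smul_mem _ _ (Submodule.mem_span_singleton_self _)))
      rw [mem_multiplesOf_succ]
      exact ⟨_, FiberCone.mem_gradedPiece.2 ⟨b, hb, rfl⟩, map_initialForm_mul_of hx.1 hb hxb⟩
  constructor
  · have hk := key (r - 1) (by omega) (by omega)
    rw [Nat.sub_add_cancel (by omega)] at hk
    refine eq_one_of_existsUnique_index hk fun t ht => ?_
    have := t.1.2
    omega
  · have hk := key (r - 2) (by omega) (by omega)
    rw [show r - 2 + 1 = r - 1 by omega] at hk
    refine eq_one_of_existsUnique_index hk fun t ht => ?_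
    have ht' := t.1.2
    -- A torsion summand in degree r - 1 has j = 1 because i + j ≤ r; injectivity of x* in that
    -- degree then makes its generator zero.
    have hkill : initialForm x ^ 1 • CyclicSum.gen (initialForm x)
        (fun t : TorsionIndex r τ => t.1.1.2) (Sum.inr t : FreeIndex r α ⊕ _) = 0 :=
      CyclicSum.pow_smul_gen_inr _ _ (by omega)
    have hmul := congrArg φ hkill
    rw [pow_one, map_smul, map_zero] at hmul
    have h0 := eq_zero_of_initialForm_mul_eq_zero hreg hx.1 ((hr _).2 (by omega)) (htor t) hmul
    rw [LinearEquiv.map_eq_zero_iff] at h0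
    have h1 := hp1 (Sum.inr t)
    rw [h0, map_zero] at h1
    have : Nontrivial (NoetherNormalization x ⧸ Ideal.span {initialForm x}) :=
      Ideal.Quotient.nontrivial_iff.2 span_initialForm_ne_top
    exact zero_ne_one h1

end TangentCone

end TangentConeInvariants

/-! ### The three statements assembled. -/

open TangentConeInvariants in
theorem mainTheorem11 {A : Type*} [CommRing A] [IsLocalRing A] [IsNoetherianRing A]
    (hdim : ringKrullDim A = 1) (hCM : IsCohenMacaulay A)
    (hres : Infinite (ResidueField A))
    (halmost : HasAlmostMinimalMultiplicity A)
    (r : ℕ) (hr : r = reductionNumber A) (hr3 : 3 ≤ r)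
    (x : A) (hx : GeneratesMinimalReduction x) :
    (aperyInvariant x 1 + 2 = (ringMultiplicity A : ℕ∞) ∧ aperyInvariant x 2 = 1 ∧
      ∀ i : ℕ, 3 ≤ i → i ≤ r → aperyInvariant x i = 0) ∧
    ((∃ (α : ℕ → ℕ) (τ : ℕ → ℕ → ℕ), AreTangentConeInvariants x hx.prop.1 r α τ) ∧
      ∀ (α : ℕ → ℕ) (τ : ℕ → ℕ → ℕ), AreTangentConeInvariants x hx.prop.1 r α τ →
        α r = 1 ∧ α (r - 1) = 1) ∧
    (microLength A (r - 1) ≠ ⊤ ∧ microLength A r ≠ ⊤ ∧ microInvariant A r = 0) := by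
  have hreg := hx.prop.mem_nonZeroDivisors hCM hdim
  have hpow := pow_succ_eq_iff_reductionNumber_le hdim hCM hx
  rw [← hr] at hpow
  obtain ⟨h1, h2, h3, h4⟩ := aperyInvariant_eq hreg hx.prop halmost fun h => by
    have := (hpow 1).1 (by simpa using h)
    omega
  refine ⟨⟨h1, h2, fun i hi _ => h3 i hi⟩, ⟨exists_areTangentConeInvariants hreg hx.prop fun n => (hpow n).2,
    fun α τ => tangentConeInvariants_eq_one hreg hx.prop hpow hr3 halmost⟩, ?_⟩
  -- The filtration already equals A at i = r - 1, because r ≥ 3 gives 𝔪ⁱ⁺¹ ⊆ 𝔪³ ⊆ xA.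
  have hone : ∀ i, r ≤ i + 1 → neighborhoodFiltration A i = 1 := fun i hi =>
    neighborhoodFiltration_eq_one hreg (hx.prop.1 (Ideal.mem_span_singleton_self x))
      (fun n hn => (hpow n).2 (by omega)) ((Ideal.pow_le_pow_right (by omega)).trans h4)
  have hzero : ∀ i, r ≤ i + 1 → microLength A i = 0 := fun i hi => by
    rw [microLength, hone i hi, hone (i + 1) (by omega)]
    exact relLength_eq_zero le_rfl
  obtain ⟨s, rfl⟩ : ∃ s, r = s + 1 := ⟨r - 1, by omega⟩
  rw [Nat.add_sub_cancel, microInvariant, hzero s le_rfl, hzero (s + 1) (by omega)]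
  simp
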